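/- Fix an error probability $0<\epsilon<1/2$. Alice holds a string $A$ and Bob a string $B$ over a finite or countably infinite alphabet $\Sigma$ known to both; nothing else (in particular no bound on the lengths) is known to both. They share an infinite string of independent unbiased coin tosses and are otherwise deterministic. The task $\textsc{Lcp}$ is to output the length $\ell$ of the longest common prefix of $A$ and $B$. Let $z$ be the number of phrases in the self-referential LZ77 parse of this common prefix, that is, of the greedy left-to-right parse in which each phrase is the longest substring that has an occurrence starting strictly further left (possibly overlapping the phrase), plus the following symbol. Then there is a constant $C$ depending only on $\epsilon$ such that, for every such alphabet, each of the following holds: 1. there is a public-coin protocol that, for every pair of strings $A,B$, with probability at least $1-\epsilon$ outputs $\ell$ using at most $C(\lg z+\lg\lg \ell)$ rounds and at most $C\lg \ell$ bits of communication; 2. there is a public-coin protocol that, for every pair of strings $A,B$, with probability at least $1-\epsilon$ outputs $\ell$ using at most $C\lg z$ rounds and at most $C(\lg \ell+\lg\lg\lg |A|)$ bits of communication. Both protocols halt on all inputs and all coin strings. Here $\lg x$ denotes $\log_2\max(x,2)$, so that every (iterated) logarithm is at least $1$. A round is a maximal block of consecutive bits sent by one party. -/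

import Mathlib

open MeasureTheory

/-- The label of a vertex of a protocol tree: at an inner vertex one of the two parties sends one bit,
computed from that party's own input; at a leaf the protocol stops with an output that both parties
can read off. -/
inductive VertexLabel (X Y Z : Type*) where
  | alice (bit : X → Bool)
  | bob (bit : Y → Bool)
  | leaf (output : Z)

/-- A deterministic two-party protocol: Alice holds an element of `X`, Bob holds an element of `Y`.
The vertices reached so far are known to both parties, as the next vertex depends only on the
present one and on the bit that is sent. (The protocol tree in the usual sense is the unfolding
from the root.) -/
structure DetProtocol (X Y Z : Type*) where
  Vertex : Type
  root : Vertex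
  label : Vertex → VertexLabel X Y Z
  child : Vertex → Bool → Vertex

/-- The two parties. -/
inductive Party where
  | alice
  | bob
  deriving DecidableEq

/-- `P.Run x y v last z k c`: on inputs `x`, `y`, if the protocol stands at vertex `v` and the last
bit was sent by `last` (`none` if no bit was sent yet), then it stops with output `z` after `c` more
bits, in the course of which `k` new rounds begin. A round is a maximal block of consecutive bits
sent by the same party. -/
inductive DetProtocol.Run {X Y Z : Type*} (P : DetProtocol X Y Z) (x : X) (y : Y) :
    P.Vertex → Option Party → Z → ℕ → ℕ → Prop where
  | leaf (v : P.Vertex) (last : Option Party) (z : Z) (hv : P.label v = .leaf z) :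
      Run P x y v last z 0 0
  | alice (v : P.Vertex) (last : Option Party) (z : Z) (k c : ℕ) (f : X → Bool)
      (hv : P.label v = .alice f)
      (h : Run P x y (P.child v (f x)) (some Party.alice) z k c) :
      Run P x y v last z (k + if last = some Party.alice then 0 else 1) (c + 1)
  | bob (v : P.Vertex) (last : Option Party) (z : Z) (k c : ℕ) (f : Y → Bool)
      (hv : P.label v = .bob f)
      (h : Run P x y (P.child v (f y)) (some Party.bob) z k c) :
      Run P x y v last z (k + if last = some Party.bob then 0 else 1) (c + 1)

/-- `P.Executes x y z k c`: on inputs `x`, `y` the protocol stops with output `z`, after exactly `k`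
rounds and `c` bits of communication in total. -/
def DetProtocol.Executes {X Y Z : Type*} (P : DetProtocol X Y Z) (x : X) (y : Y)
    (z : Z) (k c : ℕ) : Prop :=
  P.Run x y P.root none z k c

/-- The shared random source: an infinite string of bits. -/
abbrev CoinString : Type := ℕ → Bool

/-- The law of an infinite string of independent unbiased coin tosses. -/
noncomputable def coinMeasure : Measure CoinString :=
  Measure.infinitePi fun _ : ℕ => (PMF.uniformOfFintype Bool).toMeasure

/-- A public-coin protocol: both parties see the coin string and are otherwise deterministic. -/
abbrev PublicCoinProtocol (X Y Z : Type*) := CoinString → DetProtocol X Y Z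

/-- The length of the longest common prefix of two strings. -/
def lcpLength {α : Type*} [DecidableEq α] : List α → List α → ℕ
  | a :: A, b :: B => if a = b then lcpLength A B + 1 else 0
  | _, _ => 0

/-- The substring of `S` of length `l` that starts at position `u` (positions count from `0`) has an
occurrence in `S` that starts strictly to the left of `u`. It may overlap position `u`. -/
def HasEarlierOccurrence {α : Type*} (S : List α) (u l : ℕ) : Prop :=
  ∃ s < u, (S.drop s).take l = (S.drop u).take l

instance {α : Type*} [DecidableEq α] (S : List α) (u l : ℕ) :
    Decidable (HasEarlierOccurrence S u l) :=
  inferInstanceAs (Decidable (∃ s < u, (S.drop s).take l = (S.drop u).take l))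

/-- The length of the longest substring starting at position `u` that has an earlier occurrence and
is followed by a symbol of `S`; it is `0` if there is none. -/
def earlierMatchLength {α : Type*} [DecidableEq α] (S : List α) (u : ℕ) : ℕ :=
  Nat.findGreatest (fun l => HasEarlierOccurrence S u l) (S.length - u - 1)

/-- The phrases of the greedy parse of `S` from position `u` on: each phrase is the longest substring
with an earlier occurrence, plus the following symbol. -/
def lz77PhrasesFrom {α : Type*} [DecidableEq α] (S : List α) (u : ℕ) : List (List α) :=
  if u < S.length then
    (S.drop u).take (earlierMatchLength S u + 1) ::
      lz77PhrasesFrom S (u + earlierMatchLength S u + 1)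
  else []
termination_by S.length - u

/-- The self-referential LZ77 parse of a string, as its list of phrases. -/
def lz77Parse {α : Type*} [DecidableEq α] (S : List α) : List (List α) :=
  lz77PhrasesFrom S 0

/-- The number of phrases of the self-referential LZ77 parse of the longest common prefix. -/
def lcpPhrases {α : Type*} [DecidableEq α] (A B : List α) : ℕ :=
  (lz77Parse (A.take (lcpLength A B))).length

/-- The binary logarithm inside `O`-bounds: arguments below `2` are replaced by `2`, so that it is
always at least `1` and (iterated) logarithms of small numbers make sense. -/
noncomputable def lg (x : ℝ) : ℝ := Real.logb 2 (max x 2)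

/-- `P` solves the longest common prefix problem with error probability at most `ε`, within
`rounds A B` rounds and `bits A B` bits of communication: it stops on all inputs and coin strings,
and for every pair of inputs, outside an event of probability at most `ε`, the output is the length
of the longest common prefix and both bounds hold. -/
def SolvesLcp {α : Type*} [DecidableEq α] (P : PublicCoinProtocol (List α) (List α) ℕ)
    (ε : ℝ) (rounds bits : List α → List α → ℝ) : Prop :=
  (∀ (r : CoinString) (A B : List α), ∃ z k c : ℕ, (P r).Executes A B z k c) ∧
  ∀ A B : List α,
    coinMeasure {r | ¬ ∃ k c : ℕ, (P r).Executes A B (lcpLength A B) k c ∧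
      (k : ℝ) ≤ rounds A B ∧ (c : ℝ) ≤ bits A B} ≤ ENNReal.ofReal ε

/-! Let `t` be the largest number such that the greedy parses of `A` and `B` agree on their first
`t` phrases. These phrases lie inside the common prefix, where they are also phrases of its own
parse, so `t` is at most the phrase count `z` and at most the length `ℓ`
(`AgreeOnPhrases.le_lcpPhrases`, `AgreeOnPhrases.le_lcpLength`).

Agreement on the first `i` phrases is monotone in `i` and can be tested by comparing hashes of
constant length `K`, with errors only towards acceptance. Galloping through powers of two bounds
`t`. A binary search that backtracks whenever its left end is rejected then finds `t` in O(log `t`)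
steps. Its potential gains 1 in each step without an error and loses at most 1 otherwise
(`extendPath_spec`), so it tolerates a constant fraction of errors. Fresh coins in each step bound
the expected number of errors, and Markov's inequality bounds the failure probability
(`coinMeasure_search_le`). Hence `K` depends on `ε` alone, and the bits as well as the rounds stay
logarithmic.

Beyond the last common boundary Alice names a source of her longest match. Each party measures how
far its own string keeps copying from that source, and `ℓ` is the smaller of the two ends
(`lcpLength_eq_min_matchEnd`): up to there both strings copy the same text, and agreement at that
position would yield one more common phrase or contradict the end of a match.

The minimum of two numbers is computed in one of two ways. Racing through the thresholds `2 ^ 2 ^ j`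
takes O(log log `ℓ`) rounds, with long messages only at the last scale (`lcpProtocol_race`).
Alternatively Alice announces the scale of her number, at a cost of O(log log log |A|) bits, and Bob
sends his number only if it is below that scale (`lcpProtocol_scale`), which takes O(1) rounds. -/

/-! ### Protocols that exchange natural numbers -/

/-- The label of a state of a message protocol: one of the parties sends a natural number, or the
protocol stops. -/
inductive MessageLabel (X Y Z : Type*) where
  | alice (msg : X → ℕ)
  | bob (msg : Y → ℕ)
  | leaf (output : Z)

/-- A two-party protocol whose messages are natural numbers. -/
structure MessageProtocol (X Y Z : Type*) where
  State : Type
  root : State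
  label : State → MessageLabel X Y Z
  next : State → ℕ → State

/-! ### A prefix-free code and the bitwise simulation of messages -/

/-- A self-delimiting code for bit strings. -/
def selfDelimit : List Bool → List Bool
  | [] => [false]
  | b :: l => true :: b :: selfDelimit l

theorem length_selfDelimit (l : List Bool) : (selfDelimit l).length = 2 * l.length + 1 := by
  induction l with
  | nil => rfl
  | cons b l ih => simp [selfDelimit, ih]; ring

/-- The flag before each bit announces whether another bit follows, so the code is prefix-free and
the end of a message is recognised without knowing its length. -/
theorem eq_of_selfDelimit_prefix {l l' : List Bool} (h : selfDelimit l <+: selfDelimit l') :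
    l = l' := by
  induction l generalizing l' with
  | nil => cases l' <;> simp_all [selfDelimit]
  | cons b l ih =>
    cases l' with
    | nil => simp [selfDelimit] at h
    | cons b' l' =>
      simp only [selfDelimit, List.cons_prefix_cons, true_and] at h
      rw [h.1, ih h.2]

/-- The code word of a natural number. -/
def codeword (n : ℕ) : List Bool := selfDelimit n.bits

theorem length_codeword (n : ℕ) : (codeword n).length = 2 * n.size + 1 := by
  rw [codeword, length_selfDelimit, Nat.size_eq_bits_len]

theorem eq_of_codeword_prefix {m n : ℕ} (h : codeword m <+: codeword n) : m = n := by
  have h1 : m.bits = n.bits := eq_of_selfDelimit_prefix h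
  have h2 : Nat.ofDigits 2 (m.bits.map fun b => cond b 1 0) =
      Nat.ofDigits 2 (n.bits.map fun b => cond b 1 0) := by rw [h1]
  rwa [← Nat.digits_two_eq_bits, ← Nat.digits_two_eq_bits, Nat.ofDigits_digits,
    Nat.ofDigits_digits] at h2

open Classical in
/-- The number encoded by a bit string, if it is a code word. -/
noncomputable def decodeWord (l : List Bool) : Option ℕ :=
  if h : ∃ n, codeword n = l then some h.choose else none

theorem decodeWord_codeword (n : ℕ) : decodeWord (codeword n) = some n := by
  have h : ∃ m, codeword m = codeword n := ⟨n, rfl⟩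
  rw [decodeWord, dif_pos h]
  refine congrArg some (eq_of_codeword_prefix ?_)
  rw [h.choose_spec]

theorem decodeWord_eq_none {n : ℕ} {l l' : List Bool} (h : codeword n = l ++ l') (hl' : l' ≠ []) :
    decodeWord l = none := by
  rw [decodeWord, dif_neg]
  rintro ⟨m, rfl⟩
  have hmn : m = n := eq_of_codeword_prefix (h ▸ List.prefix_append _ _)
  subst hmn
  exact hl' (by simpa using h)

namespace MessageProtocol

variable {X Y Z : Type*}

/-- The bitwise implementation of a message protocol. -/
noncomputable def toDet (P : MessageProtocol X Y Z) : DetProtocol X Y Z where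
  Vertex := P.State × List Bool
  root := (P.root, [])
  label v := match P.label v.1 with
    | .alice f => .alice fun x => (codeword (f x)).getD v.2.length false
    | .bob f => .bob fun y => (codeword (f y)).getD v.2.length false
    | .leaf z => .leaf z
  child v b := match decodeWord (v.2 ++ [b]) with
    | some n => (P.next v.1 n, [])
    | none => (v.1, v.2 ++ [b])

theorem toDet_child_of_eq (P : MessageProtocol X Y Z) {s : P.State} {l : List Bool} {b : Bool}
    {n : ℕ} (h : codeword n = l ++ [b]) : P.toDet.child (s, l) b = (P.next s n, []) := by
  simp [toDet, ← h, decodeWord_codeword]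

theorem toDet_child_of_ne (P : MessageProtocol X Y Z) {s : P.State} {l l' : List Bool} {b : Bool}
    {n : ℕ} (h : codeword n = l ++ b :: l') (hl' : l' ≠ []) :
    P.toDet.child (s, l) b = (s, l ++ [b]) := by
  simp [toDet, decodeWord_eq_none (l := l ++ [b]) (l' := l') (n := n) (by simpa using h) hl']

/-- `P.Run x y s z k c`: from state `s` the protocol stops with output `z` after exactly `k`
messages, whose code words have total length `c`. -/
inductive Run (P : MessageProtocol X Y Z) (x : X) (y : Y) : P.State → Z → ℕ → ℕ → Prop where
  | leaf (s : P.State) (z : Z) (hs : P.label s = .leaf z) : Run P x y s z 0 0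
  | alice (s : P.State) (z : Z) (k c : ℕ) (f : X → ℕ) (hs : P.label s = .alice f)
      (h : Run P x y (P.next s (f x)) z k c) : Run P x y s z (k + 1) (c + (2 * (f x).size + 1))
  | bob (s : P.State) (z : Z) (k c : ℕ) (f : Y → ℕ) (hs : P.label s = .bob f)
      (h : Run P x y (P.next s (f y)) z k c) : Run P x y s z (k + 1) (c + (2 * (f y).size + 1))

/-- Induction on the unsent part `l'` of the code word, while the vertex stores the part `l` already
sent. By prefix-freeness no proper prefix decodes, so the state changes exactly at the last bit. A
new round begins at most at the first of these bits. -/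
theorem toDet_run_alice (P : MessageProtocol X Y Z) {x : X} {y : Y} {s : P.State} {f : X → ℕ}
    (hs : P.label s = .alice f) {z : Z} {k c : ℕ}
    (h : P.toDet.Run x y (P.next s (f x), []) (some .alice) z k c) (l' : List Bool) :
    ∀ (l : List Bool) (last : Option Party), codeword (f x) = l ++ l' → l' ≠ [] →
      P.toDet.Run x y (s, l) last z (k + if last = some .alice then 0 else 1) (c + l'.length) := by
  induction l' with
  | nil => intro l last _ h'; exact absurd rfl h'
  | cons b l' ih =>
    intro l last hl _
    refine DetProtocol.Run.alice (P := P.toDet) (s, l) last z k (c + l'.length)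
      (fun x => (codeword (f x)).getD l.length false) (by simp [toDet, hs]) ?_
    have hb : (codeword (f x)).getD l.length false = b := by simp [hl]
    rw [hb]
    by_cases hl' : l' = []
    · subst hl'
      rw [toDet_child_of_eq P hl]
      exact h
    · rw [toDet_child_of_ne P hl hl']
      simpa using ih (l ++ [b]) (some .alice) (by simpa using hl) hl'

theorem toDet_run_bob (P : MessageProtocol X Y Z) {x : X} {y : Y} {s : P.State} {f : Y → ℕ}
    (hs : P.label s = .bob f) {z : Z} {k c : ℕ}
    (h : P.toDet.Run x y (P.next s (f y), []) (some .bob) z k c) (l' : List Bool) :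
    ∀ (l : List Bool) (last : Option Party), codeword (f y) = l ++ l' → l' ≠ [] →
      P.toDet.Run x y (s, l) last z (k + if last = some .bob then 0 else 1) (c + l'.length) := by
  induction l' with
  | nil => intro l last _ h'; exact absurd rfl h'
  | cons b l' ih =>
    intro l last hl _
    refine DetProtocol.Run.bob (P := P.toDet) (s, l) last z k (c + l'.length)
      (fun x => (codeword (f x)).getD l.length false) (by simp [toDet, hs]) ?_
    have hb : (codeword (f y)).getD l.length false = b := by simp [hl]
    rw [hb]
    by_cases hl' : l' = []
    · subst hl'
      rw [toDet_child_of_eq P hl]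
      exact h
    · rw [toDet_child_of_ne P hl hl']
      simpa using ih (l ++ [b]) (some .bob) (by simpa using hl) hl'

theorem codeword_ne_nil (n : ℕ) : codeword n ≠ [] := by
  rw [← List.length_pos_iff, length_codeword]; omega

/-- Rounds are only bounded by the number of messages, since consecutive messages of one party merge
into one round. -/
theorem Run.toDet {P : MessageProtocol X Y Z} {x : X} {y : Y} {s : P.State} {z : Z} {k c : ℕ}
    (h : P.Run x y s z k c) :
    ∀ last, ∃ k' ≤ k, P.toDet.Run x y (s, []) last z k' c := by
  induction h with
  | leaf s z hs => exact fun last => ⟨0, le_rfl, .leaf _ _ _ (by simp [MessageProtocol.toDet, hs])⟩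
  | alice s z k c f hs _ ih =>
    intro last
    obtain ⟨k', hk', hr⟩ := ih (some .alice)
    have := toDet_run_alice P hs hr (codeword (f x)) [] last rfl (codeword_ne_nil _)
    rw [length_codeword] at this
    exact ⟨_, by split <;> omega, this⟩
  | bob s z k c f hs _ ih =>
    intro last
    obtain ⟨k', hk', hr⟩ := ih (some .bob)
    have := toDet_run_bob P hs hr (codeword (f y)) [] last rfl (codeword_ne_nil _)
    rw [length_codeword] at this
    exact ⟨_, by split <;> omega, this⟩

/-- From state `s` the protocol stops with output `z` after at most `k` messages, whose code words
have total length at most `c`. -/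
def RunLE (P : MessageProtocol X Y Z) (x : X) (y : Y) (s : P.State) (z : Z) (k c : ℕ) : Prop :=
  ∃ k' ≤ k, ∃ c' ≤ c, P.Run x y s z k' c'

theorem RunLE.mono {P : MessageProtocol X Y Z} {x : X} {y : Y} {s : P.State} {z : Z}
    {k c k' c' : ℕ} (h : P.RunLE x y s z k c) (hk : k ≤ k') (hc : c ≤ c') :
    P.RunLE x y s z k' c' :=
  let ⟨k₀, hk₀, c₀, hc₀, h₀⟩ := h
  ⟨k₀, hk₀.trans hk, c₀, hc₀.trans hc, h₀⟩

theorem RunLE.leaf {P : MessageProtocol X Y Z} {x : X} {y : Y} {s : P.State} {z : Z}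
    (hs : P.label s = .leaf z) : P.RunLE x y s z 0 0 :=
  ⟨0, le_rfl, 0, le_rfl, .leaf s z hs⟩

theorem RunLE.alice {P : MessageProtocol X Y Z} {x : X} {y : Y} {s : P.State} {z : Z} {k c : ℕ}
    {f : X → ℕ} (hs : P.label s = .alice f) (h : P.RunLE x y (P.next s (f x)) z k c) :
    P.RunLE x y s z (k + 1) (c + (2 * (f x).size + 1)) :=
  let ⟨_, hk₀, _, hc₀, h₀⟩ := h
  ⟨_, Nat.add_le_add_right hk₀ 1, _, Nat.add_le_add_right hc₀ _, .alice _ _ _ _ f hs h₀⟩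

theorem RunLE.bob {P : MessageProtocol X Y Z} {x : X} {y : Y} {s : P.State} {z : Z} {k c : ℕ}
    {f : Y → ℕ} (hs : P.label s = .bob f) (h : P.RunLE x y (P.next s (f y)) z k c) :
    P.RunLE x y s z (k + 1) (c + (2 * (f y).size + 1)) :=
  let ⟨_, hk₀, _, hc₀, h₀⟩ := h
  ⟨_, Nat.add_le_add_right hk₀ 1, _, Nat.add_le_add_right hc₀ _, .bob _ _ _ _ f hs h₀⟩

theorem RunLE.executes {P : MessageProtocol X Y Z} {x : X} {y : Y} {z : Z} {k c : ℕ}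
    (h : P.RunLE x y P.root z k c) :
    ∃ k' ≤ k, ∃ c' ≤ c, P.toDet.Executes x y z k' c' := by
  obtain ⟨k₁, hk₁, c₁, hc₁, h₁⟩ := h
  obtain ⟨k₂, hk₂, h₂⟩ := h₁.toDet none
  exact ⟨k₂, hk₂.trans hk₁, c₁, hc₁, h₂⟩

end MessageProtocol

/-! ### The greedy parse and the longest common prefix -/

section Parse

variable {α : Type*} [DecidableEq α]

theorem le_lcpLength_iff {A B : List α} {l : ℕ} :
    l ≤ lcpLength A B ↔ ∀ i < l, ∃ a, A[i]? = some a ∧ B[i]? = some a := by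
  induction A generalizing B l with
  | nil =>
    simp only [lcpLength, Nat.le_zero]
    refine ⟨by rintro rfl; simp, fun h => ?_⟩
    by_contra hl
    simpa using h 0 (Nat.pos_of_ne_zero hl)
  | cons a A ih =>
    cases B with
    | nil =>
      simp only [lcpLength, Nat.le_zero]
      refine ⟨by rintro rfl; simp, fun h => ?_⟩
      by_contra hl
      simpa using h 0 (Nat.pos_of_ne_zero hl)
    | cons b B =>
      cases l with
      | zero => simp
      | succ l =>
        rw [lcpLength]
        split_ifs with hab
        · subst hab
          rw [Nat.add_le_add_iff_right, ih]
          constructor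
          · intro h i hi
            cases i with
            | zero => exact ⟨a, by simp⟩
            | succ i => simpa using h i (by omega)
          · intro h i hi
            simpa using h (i + 1) (by omega)
        · refine ⟨by omega, fun h => ?_⟩
          obtain ⟨c, h1, h2⟩ := h 0 (by omega)
          simp at h1 h2
          exact absurd (h1.trans h2.symm) hab

theorem lcpLength_le_left (A B : List α) : lcpLength A B ≤ A.length := by
  by_contra h
  obtain ⟨a, h1, -⟩ := le_lcpLength_iff.1 le_rfl A.length (not_le.1 h)
  simp at h1

theorem hasEarlierOccurrence_iff {S : List α} {u l : ℕ} (h : u + l ≤ S.length) :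
    HasEarlierOccurrence S u l ↔ ∃ s < u, l ≤ lcpLength (S.drop u) (S.drop s) := by
  unfold HasEarlierOccurrence
  refine exists_congr fun s => and_congr_right fun hs => ?_
  rw [le_lcpLength_iff]
  constructor
  · intro he i hi
    have h1 := congrArg (fun L : List α => L[i]?) he
    simp only [List.getElem?_take, hi, if_true, List.getElem?_drop] at h1
    have h2 : u + i < S.length := by omega
    refine ⟨S[u + i], by simp [h2], ?_⟩
    rw [List.getElem?_drop, h1]
    simp [h2]
  · intro hi
    apply List.ext_getElem?
    intro i
    rw [List.getElem?_take, List.getElem?_take]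
    split_ifs with hil
    · obtain ⟨a, h1, h2⟩ := hi i hil
      rw [h1, h2]
    · rfl

theorem earlierMatchLength_eq {S : List α} {u m : ℕ} (hm : u + m < S.length)
    (h₁ : m ≠ 0 → ∃ s < u, m ≤ lcpLength (S.drop u) (S.drop s))
    (h₂ : ∀ l, u + l < S.length → ∀ s < u, l ≤ lcpLength (S.drop u) (S.drop s) → l ≤ m) :
    earlierMatchLength S u = m := by
  refine Nat.findGreatest_eq_iff.2 ⟨by omega, fun h0 => ?_, fun n hmn hn hP => ?_⟩
  · exact (hasEarlierOccurrence_iff hm.le).2 (h₁ h0)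
  · obtain ⟨s, hs, hl⟩ := (hasEarlierOccurrence_iff (by omega)).1 hP
    exact absurd (h₂ n (by omega) s hs hl) (by omega)

theorem add_earlierMatchLength_lt {S : List α} {u : ℕ} (hu : u < S.length) :
    u + earlierMatchLength S u < S.length := by
  have := Nat.findGreatest_le (P := fun l => HasEarlierOccurrence S u l) (S.length - u - 1)
  unfold earlierMatchLength
  omega

/-- A phrase that ends within a prefix is unaffected by the rest of the string: an occurrence
starting further left also ends further left, hence inside the prefix. -/
theorem earlierMatchLength_take {S : List α} {u n : ℕ} (hu : u < S.length) (hn : n ≤ S.length)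
    (h : u + earlierMatchLength S u + 1 ≤ n) :
    earlierMatchLength (S.take n) u = earlierMatchLength S u := by
  have hlcp : ∀ l s, u + l ≤ n → s < u → (l ≤ lcpLength ((S.take n).drop u) ((S.take n).drop s) ↔
      l ≤ lcpLength (S.drop u) (S.drop s)) := by
    intro l s hl hs
    rw [le_lcpLength_iff, le_lcpLength_iff]
    refine forall₂_congr fun i hi => ?_
    simp only [List.getElem?_drop, List.getElem?_take]
    rw [if_pos (by omega), if_pos (by omega)]
  have hS := (Nat.findGreatest_eq_iff (P := fun l => HasEarlierOccurrence S u l)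
    (k := S.length - u - 1)).1 (rfl : earlierMatchLength S u = _)
  obtain ⟨h1, h2, h3⟩ := hS
  have hlen : (S.take n).length = n := by simp [hn]
  refine earlierMatchLength_eq (by omega) (fun h0 => ?_) (fun l hl s hs hls => ?_)
  · obtain ⟨s, hs, hls⟩ := (hasEarlierOccurrence_iff (by omega)).1 (h2 h0)
    exact ⟨s, hs, (hlcp _ s (by omega) hs).2 hls⟩
  · by_contra hlt
    exact h3 (not_le.1 hlt) (by omega)
      ((hasEarlierOccurrence_iff (by omega)).2 ⟨s, hs, (hlcp l s (by omega) hs).1 hls⟩)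

/-- The start of the phrase after the one that starts at position `u`. -/
def nextPhraseStart (S : List α) (u : ℕ) : ℕ :=
  if u < S.length then u + earlierMatchLength S u + 1 else u

/-- The position at which phrase number `i` of the greedy parse starts. -/
def phraseStart (S : List α) (i : ℕ) : ℕ := (nextPhraseStart S)^[i] 0

theorem phraseStart_zero (S : List α) : phraseStart S 0 = 0 := rfl

theorem phraseStart_succ (S : List α) (i : ℕ) :
    phraseStart S (i + 1) = nextPhraseStart S (phraseStart S i) :=
  Function.iterate_succ_apply' _ _ _

theorem phraseStart_le (S : List α) (i : ℕ) : phraseStart S i ≤ S.length := by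
  induction i with
  | zero => simp [phraseStart_zero]
  | succ i ih =>
    rw [phraseStart_succ, nextPhraseStart]
    split_ifs with h
    · exact add_earlierMatchLength_lt h
    · exact ih

theorem phraseStart_mono (S : List α) : Monotone (phraseStart S) := by
  refine monotone_nat_of_le_succ fun i => ?_
  rw [phraseStart_succ, nextPhraseStart]
  split_ifs <;> omega

theorem lz77PhrasesFrom_getElem? (S : List α) (i : ℕ) : ∀ u,
    (lz77PhrasesFrom S u)[i]? = if (nextPhraseStart S)^[i] u < S.length then
      some ((S.drop ((nextPhraseStart S)^[i] u)).take
        (earlierMatchLength S ((nextPhraseStart S)^[i] u) + 1)) else none := by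
  induction i with
  | zero =>
    intro u
    rw [lz77PhrasesFrom, Function.iterate_zero_apply]
    split_ifs with h <;> simp
  | succ i ih =>
    intro u
    rw [lz77PhrasesFrom, Function.iterate_succ_apply]
    have hfix : ∀ j, ¬ u < S.length → (nextPhraseStart S)^[j] u = u := fun j h =>
      Function.iterate_fixed (show nextPhraseStart S u = u from if_neg h) j
    by_cases h : u < S.length
    · rw [if_pos h, List.getElem?_cons_succ, ih, nextPhraseStart, if_pos h]
    · have h' : nextPhraseStart S u = u := if_neg h
      rw [if_neg h, h', hfix i h, if_neg h]
      simp

theorem lz77Parse_getElem? (S : List α) (i : ℕ) :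
    (lz77Parse S)[i]? = if phraseStart S i < S.length then
      some ((S.drop (phraseStart S i)).take (earlierMatchLength S (phraseStart S i) + 1))
      else none :=
  lz77PhrasesFrom_getElem? S i 0

theorem lt_length_lz77Parse {S : List α} {i : ℕ} :
    i < (lz77Parse S).length ↔ phraseStart S i < S.length := by
  rw [← not_iff_not, not_lt, ← List.getElem?_eq_none_iff, lz77Parse_getElem?]
  split_ifs with h <;> simp [h]

theorem phraseStart_lt_succ {S : List α} {i : ℕ} (h : i < (lz77Parse S).length) :
    phraseStart S i < phraseStart S (i + 1) := by
  rw [phraseStart_succ, nextPhraseStart, if_pos (lt_length_lz77Parse.1 h)]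
  omega

theorem le_phraseStart {S : List α} {i : ℕ} (h : i ≤ (lz77Parse S).length) :
    i ≤ phraseStart S i := by
  induction i with
  | zero => simp
  | succ i ih =>
    have := phraseStart_lt_succ (S := S) (i := i) h
    have := ih (by omega)
    omega

theorem phraseStart_take {S : List α} {n i : ℕ} (hn : n ≤ S.length) (hi : phraseStart S i ≤ n) :
    phraseStart (S.take n) i = phraseStart S i := by
  induction i with
  | zero => rfl
  | succ i ih =>
    have hlen : (S.take n).length = n := by simp [hn]
    have ih' := ih ((phraseStart_mono S (Nat.le_succ i)).trans hi)
    rw [phraseStart_succ] at hi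
    rw [phraseStart_succ, phraseStart_succ, ih']
    unfold nextPhraseStart at hi ⊢
    rw [hlen]
    split_ifs at hi with h
    · rw [if_pos h, if_pos (by omega), earlierMatchLength_take h hn hi]
    · rw [if_neg h, if_neg (by omega)]

/-! ### Common phrases of two strings -/

/-- Both strings have at least `i` phrases, and their first `i` phrases agree. -/
def AgreeOnPhrases (A B : List α) (i : ℕ) : Prop :=
  i ≤ (lz77Parse A).length ∧ i ≤ (lz77Parse B).length ∧
    (lz77Parse A).take i = (lz77Parse B).take i

theorem AgreeOnPhrases.mono {A B : List α} {i j : ℕ} (h : AgreeOnPhrases A B j) (hij : i ≤ j) :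
    AgreeOnPhrases A B i := by
  refine ⟨hij.trans h.1, hij.trans h.2.1, ?_⟩
  have := congrArg (List.take i) h.2.2
  simpa [List.take_take, hij] using this

theorem agreeOnPhrases_zero (A B : List α) : AgreeOnPhrases A B 0 := by simp [AgreeOnPhrases]

theorem agreeOnPhrases_succ_iff {A B : List α} {i : ℕ} :
    AgreeOnPhrases A B (i + 1) ↔ AgreeOnPhrases A B i ∧
      phraseStart A i < A.length ∧ phraseStart B i < B.length ∧
      (A.drop (phraseStart A i)).take (earlierMatchLength A (phraseStart A i) + 1) =
      (B.drop (phraseStart B i)).take (earlierMatchLength B (phraseStart B i) + 1) := by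
  constructor
  · intro h
    have hA := lt_length_lz77Parse.1 (show i < (lz77Parse A).length from h.1)
    have hB := lt_length_lz77Parse.1 (show i < (lz77Parse B).length from h.2.1)
    refine ⟨h.mono (Nat.le_succ i), hA, hB, ?_⟩
    have := congrArg (fun L : List (List α) => L[i]?) h.2.2
    simp only [List.getElem?_take, Nat.lt_succ_self, if_true, lz77Parse_getElem?, if_pos hA,
      if_pos hB] at this
    exact Option.some_injective _ this
  · rintro ⟨h, hA, hB, he⟩
    refine ⟨lt_length_lz77Parse.2 hA, lt_length_lz77Parse.2 hB, ?_⟩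
    rw [List.take_add_one, List.take_add_one, h.2.2, lz77Parse_getElem?, lz77Parse_getElem?,
      if_pos hA, if_pos hB, he]

theorem AgreeOnPhrases.prefix_eq {A B : List α} {i : ℕ} (h : AgreeOnPhrases A B i) :
    phraseStart A i = phraseStart B i ∧ A.take (phraseStart A i) = B.take (phraseStart A i) := by
  induction i with
  | zero => simp [phraseStart_zero]
  | succ i ih =>
    obtain ⟨hi, hA, hB, he⟩ := agreeOnPhrases_succ_iff.1 h
    obtain ⟨h1, h2⟩ := ih hi
    rw [← h1] at hB he
    have hmA := add_earlierMatchLength_lt hA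
    have hmB := add_earlierMatchLength_lt hB
    have hm : earlierMatchLength A (phraseStart A i) = earlierMatchLength B (phraseStart A i) := by
      have := congrArg List.length he
      simp only [List.length_take, List.length_drop] at this
      omega
    rw [phraseStart_succ, phraseStart_succ, ← h1, nextPhraseStart, nextPhraseStart, if_pos hA,
      if_pos hB, hm]
    refine ⟨rfl, ?_⟩
    rw [hm] at he
    rw [add_assoc, List.take_add (l := A), List.take_add (l := B), h2, he]

theorem AgreeOnPhrases.phraseStart_le_lcpLength {A B : List α} {i : ℕ}
    (h : AgreeOnPhrases A B i) : phraseStart A i ≤ lcpLength A B := by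
  obtain ⟨h1, h2⟩ := h.prefix_eq
  refine le_lcpLength_iff.2 fun j hj => ?_
  have hA : j < A.length := hj.trans_le (phraseStart_le A i)
  have := congrArg (fun L : List α => L[j]?) h2
  simp only [List.getElem?_take, hj, if_true] at this
  exact ⟨A[j], by simp, by rw [← this]; simp⟩

theorem AgreeOnPhrases.le_lcpLength {A B : List α} {i : ℕ}
    (h : AgreeOnPhrases A B i) : i ≤ lcpLength A B :=
  (le_phraseStart h.1).trans h.phraseStart_le_lcpLength

theorem AgreeOnPhrases.le_lcpPhrases {A B : List α} {i : ℕ}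
    (h : AgreeOnPhrases A B i) : i ≤ lcpPhrases A B := by
  cases i with
  | zero => simp
  | succ i =>
    have h1 := h.phraseStart_le_lcpLength
    have h2 := phraseStart_lt_succ (S := A) (i := i) h.1
    have hn := lcpLength_le_left A B
    refine lt_length_lz77Parse.2 ?_
    rw [phraseStart_take hn (h2.le.trans h1)]
    simp only [List.length_take]
    omega

/-! ### The common prefix beyond the last common phrase -/

/-- The end of the longest match between the strings that start at the source `s` and at the start
of phrase number `i`, provided that the source lies to the left of the phrase. -/
def matchEnd (S : List α) (i s : ℕ) : ℕ :=
  phraseStart S i +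
    if s < phraseStart S i then lcpLength (S.drop (phraseStart S i)) (S.drop s) else 0

/-- Unlike `earlierMatchLength`, the maximised match may run to the end of the string, with no
symbol reserved to follow it. At boundary 0 there is no proper source, and 0 serves as a default. -/
theorem exists_bestSource (S : List α) (i : ℕ) :
    ∃ s, s ≤ phraseStart S i ∧ (0 < phraseStart S i → s < phraseStart S i) ∧
      ∀ s' < phraseStart S i, lcpLength (S.drop (phraseStart S i)) (S.drop s') ≤
        lcpLength (S.drop (phraseStart S i)) (S.drop s) := by
  rcases Nat.eq_zero_or_pos (phraseStart S i) with h | h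
  · exact ⟨0, by omega, by omega, by omega⟩
  · obtain ⟨s, hs, hmax⟩ := Finset.exists_max_image (Finset.range (phraseStart S i))
      (fun s => lcpLength (S.drop (phraseStart S i)) (S.drop s)) ⟨0, by simpa using h⟩
    simp only [Finset.mem_range] at hs hmax
    exact ⟨s, hs.le, fun _ => hs, hmax⟩

/-- A source for the longest match with the string that starts with phrase number `i`. -/
noncomputable def bestSource (S : List α) (i : ℕ) : ℕ := (exists_bestSource S i).choose

theorem bestSource_le (S : List α) (i : ℕ) : bestSource S i ≤ phraseStart S i :=
  (exists_bestSource S i).choose_spec.1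

theorem bestSource_lt {S : List α} {i : ℕ} (h : 0 < phraseStart S i) :
    bestSource S i < phraseStart S i :=
  (exists_bestSource S i).choose_spec.2.1 h

theorem lcpLength_le_bestSource {S : List α} {i s : ℕ} (h : s < phraseStart S i) :
    lcpLength (S.drop (phraseStart S i)) (S.drop s) ≤
      lcpLength (S.drop (phraseStart S i)) (S.drop (bestSource S i)) :=
  (exists_bestSource S i).choose_spec.2.2 s h

theorem matchEnd_le_length (S : List α) (i s : ℕ) : matchEnd S i s ≤ S.length := by
  have h1 := phraseStart_le S i
  have h2 := lcpLength_le_left (S.drop (phraseStart S i)) (S.drop s)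
  rw [List.length_drop] at h2
  unfold matchEnd
  split_ifs <;> omega

theorem getElem?_of_lt_lcpLength {A B : List α} {i : ℕ} (h : i < lcpLength A B) :
    ∃ a, A[i]? = some a ∧ B[i]? = some a :=
  le_lcpLength_iff.1 le_rfl i h

theorem lt_matchEnd {S : List α} {i s j : ℕ} (h₁ : phraseStart S i ≤ j) (h₂ : j < matchEnd S i s) :
    s < phraseStart S i ∧ ∃ a, S[j]? = some a ∧ S[s + (j - phraseStart S i)]? = some a := by
  unfold matchEnd at h₂
  split_ifs at h₂ with hs
  · obtain ⟨a, ha, hb⟩ := getElem?_of_lt_lcpLength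
      (show j - phraseStart S i < lcpLength (S.drop (phraseStart S i)) (S.drop s) by omega)
    rw [List.getElem?_drop] at ha hb
    rw [show phraseStart S i + (j - phraseStart S i) = j by omega] at ha
    exact ⟨hs, a, ha, hb⟩
  · omega

theorem matchEnd_ne {S : List α} {i s : ℕ} (hs : s < phraseStart S i) {a : α}
    (h : S[matchEnd S i s]? = some a) :
    S[s + (matchEnd S i s - phraseStart S i)]? ≠ some a := by
  intro hb
  have hle : lcpLength (S.drop (phraseStart S i)) (S.drop s) + 1 ≤
      lcpLength (S.drop (phraseStart S i)) (S.drop s) := by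
    have he : matchEnd S i s =
        phraseStart S i + lcpLength (S.drop (phraseStart S i)) (S.drop s) := by
      rw [matchEnd, if_pos hs]
    refine le_lcpLength_iff.2 fun j hj => ?_
    rcases Nat.lt_succ_iff_lt_or_eq.1 hj with hj | rfl
    · exact getElem?_of_lt_lcpLength hj
    · refine ⟨a, ?_, ?_⟩
      · rw [List.getElem?_drop, ← he, h]
      · rw [List.getElem?_drop, ← hb, he, Nat.add_sub_cancel_left]
  omega

theorem earlierMatchLength_of_phraseStart_eq_zero {S : List α} {u : ℕ} (hu : u = 0)
    (hS : 0 < S.length) : earlierMatchLength S u = 0 := by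
  subst hu
  exact earlierMatchLength_eq (by omega) (by simp) (by simp)

/-- A source that is optimal for `A` alone suffices: if both matches end at the same position and
the strings agree there too, the source is optimal for `B` as well, and the next phrases coincide.
-/
theorem lcpLength_eq_min_matchEnd {A B : List α} {i : ℕ} (h : AgreeOnPhrases A B i)
    (h' : ¬ AgreeOnPhrases A B (i + 1)) :
    lcpLength A B = min (matchEnd A i (bestSource A i)) (matchEnd B i (bestSource A i)) := by
  obtain ⟨hu, -⟩ := h.prefix_eq
  have hlcp := h.phraseStart_le_lcpLength
  set s := bestSource A i with hs
  have hub : phraseStart A i ≤ matchEnd A i s := Nat.le_add_right _ _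
  have hub' : phraseStart B i ≤ matchEnd B i s := Nat.le_add_right _ _
  refine le_antisymm ?_ ?_
  · by_contra! hlt
    have hAB : ∀ j ≤ min (matchEnd A i s) (matchEnd B i s),
        ∃ a, A[j]? = some a ∧ B[j]? = some a := fun j hj =>
      getElem?_of_lt_lcpLength (hj.trans_lt hlt)
    have hABe : ∀ j ≤ min (matchEnd A i s) (matchEnd B i s), A[j]? = B[j]? := fun j hj => by
      obtain ⟨a, h1, h2⟩ := hAB j hj
      rw [h1, h2]
    rcases Nat.eq_zero_or_pos (phraseStart A i) with h0 | hpos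
    · have h0' : phraseStart B i = 0 := by omega
      have hm : matchEnd A i s = 0 := by simp [matchEnd, h0]
      obtain ⟨a, h1, h2⟩ := hAB 0 (by omega)
      have hA : 0 < A.length := by
        by_contra hc
        rw [List.getElem?_eq_none (by omega)] at h1; simp at h1
      have hB : 0 < B.length := by
        by_contra hc
        rw [List.getElem?_eq_none (by omega)] at h2; simp at h2
      refine h' (agreeOnPhrases_succ_iff.2 ⟨h, by omega, by omega, ?_⟩)
      rw [earlierMatchLength_of_phraseStart_eq_zero h0 hA,
        earlierMatchLength_of_phraseStart_eq_zero h0' hB, h0, h0']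
      cases A with
      | nil => simp at hA
      | cons a' A =>
        cases B with
        | nil => simp at hB
        | cons b' B => simp_all
    · have hsA : s < phraseStart A i := bestSource_lt hpos
      have hsB : s < phraseStart B i := hu ▸ hsA
      rcases lt_trichotomy (matchEnd A i s) (matchEnd B i s) with hlt' | heq | hlt'
      -- At Alice's match end Bob's string still copies from `s`. The strings agree at this position
      -- and at the copied one, so Alice's match would continue.
      · obtain ⟨-, a, h1, h2⟩ := lt_matchEnd (hu ▸ hub) hlt'
        rw [← hu] at h2
        rw [← hABe _ (by omega)] at h1 h2
        exact matchEnd_ne hsA h1 h2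
      · set e := matchEnd A i s with he
        obtain ⟨a, ha, hb⟩ := hAB e (by omega)
        have hAl : e < A.length := by
          by_contra hc
          rw [List.getElem?_eq_none (by omega)] at ha; simp at ha
        have hBl : e < B.length := by
          by_contra hc
          rw [List.getElem?_eq_none (by omega)] at hb; simp at hb
        have heA : lcpLength (A.drop (phraseStart A i)) (A.drop s) = e - phraseStart A i := by
          rw [he, matchEnd, if_pos hsA]; omega
        have heB : lcpLength (B.drop (phraseStart B i)) (B.drop s) = e - phraseStart A i := by
          rw [heq, matchEnd, if_pos hsB]; omega
        have hmA : earlierMatchLength A (phraseStart A i) = e - phraseStart A i := by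
          refine earlierMatchLength_eq (by omega) (fun _ => ⟨s, hsA, heA.ge⟩) fun l _ s' hs' hl => ?_
          exact hl.trans ((lcpLength_le_bestSource hs').trans heA.le)
        have hmB : earlierMatchLength B (phraseStart B i) = e - phraseStart A i := by
          refine earlierMatchLength_eq (by omega) (fun _ => ⟨s, hsB, heB.ge⟩) fun l _ s' hs' hl => ?_
          by_contra hlt
          -- A longer match in `B` involves up to this length only positions at most `e`, where the
          -- strings agree; so it transfers to `A` and beats the best source.
          have h1 : e - phraseStart A i + 1 ≤ lcpLength (A.drop (phraseStart A i)) (A.drop s') := by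
            refine le_lcpLength_iff.2 fun j hj => ?_
            obtain ⟨b, hb1, hb2⟩ := le_lcpLength_iff.1 hl j (by omega)
            rw [List.getElem?_drop] at hb1 hb2
            rw [← hu] at hb1
            rw [← hABe _ (by omega)] at hb1 hb2
            exact ⟨b, by rwa [List.getElem?_drop], by rwa [List.getElem?_drop]⟩
          have h2 := lcpLength_le_bestSource (S := A) (i := i) (hu ▸ hs' : s' < phraseStart A i)
          rw [← hs] at h2
          omega
        refine h' (agreeOnPhrases_succ_iff.2 ⟨h, by omega, by omega, ?_⟩)
        rw [hmA, hmB]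
        apply List.ext_getElem?
        intro j
        simp only [List.getElem?_take, List.getElem?_drop]
        split_ifs with hj
        · rw [← hu, hABe _ (by omega)]
        · rfl
      · obtain ⟨-, a, h1, h2⟩ := lt_matchEnd (hu ▸ hub') hlt'
        rw [hu] at h2
        rw [hABe _ (by omega)] at h1 h2
        exact matchEnd_ne hsB h1 h2
  · refine le_lcpLength_iff.2 fun j => ?_
    -- The source may overlap the phrase, but the copied position lies strictly left of `j`, so
    -- agreement there is already known.
    induction j using Nat.strong_induction_on with
    | _ j ih =>
      intro hj
      rcases lt_or_ge j (phraseStart A i) with hju | hju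
      · exact getElem?_of_lt_lcpLength (hju.trans_le hlcp)
      · obtain ⟨hsA, a, h1, h2⟩ := lt_matchEnd (S := A) (s := s) hju (by omega)
        obtain ⟨-, b, h3, h4⟩ := lt_matchEnd (S := B) (s := s) (hu ▸ hju) (by omega)
        obtain ⟨c, h5, h6⟩ := ih (s + (j - phraseStart A i)) (by omega) (by omega)
        rw [← hu] at h4
        have hac : a = c := by rw [h2] at h5; exact Option.some_injective _ h5
        have hbc : b = c := by rw [h4] at h6; exact Option.some_injective _ h6
        subst hac hbc
        exact ⟨_, h1, h3⟩

theorem exists_last_agreeOnPhrases (A B : List α) :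
    ∃ t, ∀ i, AgreeOnPhrases A B i ↔ i ≤ t := by
  classical
  refine ⟨Nat.findGreatest (AgreeOnPhrases A B) (lz77Parse A).length, fun i => ⟨fun h => ?_, ?_⟩⟩
  · exact Nat.le_findGreatest h.1 h
  · exact fun h => (Nat.findGreatest_spec (Nat.zero_le _) (agreeOnPhrases_zero A B)).mono h

end Parse

/-! ### Noisy binary search with one-sided errors -/

/-- The left end of the dyadic interval reached from `[0, 2 ^ d)` along a path, whose last turn is
the head of the list. -/
def pathLow (d : ℕ) : List Bool → ℕ
  | [] => 0
  | b :: L => pathLow d L + if b then 2 ^ (d - L.length) / 2 else 0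

/-- The midpoint of the dyadic interval reached along a path. -/
def pathMid (d : ℕ) (L : List Bool) : ℕ := pathLow d L + 2 ^ (d - L.length) / 2

/-- The path after a reply: backtrack, turn left or turn right. -/
def extendPath (L : List Bool) : ℕ → List Bool
  | 0 => L.tail
  | 1 => false :: L
  | _ => true :: L

/-- The reply to the tests of the left end and of the midpoint. -/
def walkReply (low mid : Bool) : ℕ := if low then (if mid then 2 else 1) else 0

/-- The path after a number of steps of the search. -/
def searchPath (d : ℕ) (test : ℕ → ℕ → Bool) : ℕ → List Bool
  | 0 => []
  | j + 1 => extendPath (searchPath d test j)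
      (walkReply (test j (pathLow d (searchPath d test j)))
        (test j (pathMid d (searchPath d test j))))

/-- The path leads towards `t`. -/
def OnTarget (t d : ℕ) : List Bool → Prop
  | [] => True
  | b :: L => OnTarget t d L ∧ (b = true ↔ pathMid d L ≤ t)

/-- All left turns of the path are justified. -/
def LeftTurnsCorrect (t d : ℕ) : List Bool → Prop
  | [] => True
  | b :: L => LeftTurnsCorrect t d L ∧ (b = false → t < pathMid d L)

open Classical in
/-- The number of turns towards the target minus the number of the others. -/
noncomputable def pathScore (t d : ℕ) : List Bool → ℤ
  | [] => 0
  | b :: L => pathScore t d L + if OnTarget t d (b :: L) then 1 else -1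

/-- A test passes at the left end or at the midpoint although it should not. -/
def TestError (t d : ℕ) (test : ℕ → Bool) (L : List Bool) : Prop :=
  (t < pathLow d L ∧ test (pathLow d L) = true) ∨ (t < pathMid d L ∧ test (pathMid d L) = true)

theorem pathLow_le_cons (d : ℕ) (b : Bool) (L : List Bool) :
    pathLow d L ≤ pathLow d (b :: L) := Nat.le_add_right _ _

theorem pathScore_le_length (t d : ℕ) (L : List Bool) : pathScore t d L ≤ L.length := by
  induction L with
  | nil => simp [pathScore]
  | cons b L ih =>
    rw [pathScore, List.length_cons]
    split_ifs <;> push_cast <;> omega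

theorem OnTarget.pathScore_eq {t d : ℕ} {L : List Bool} (h : OnTarget t d L) :
    pathScore t d L = L.length := by
  induction L with
  | nil => rfl
  | cons b L ih => rw [pathScore, if_pos h, ih h.1, List.length_cons]; push_cast; rfl

theorem OnTarget.bounds {t d : ℕ} (ht : t < 2 ^ d) {L : List Bool} (h : OnTarget t d L) :
    pathLow d L ≤ t ∧ t < pathLow d L + 2 ^ (d - L.length) := by
  induction L with
  | nil => simpa [pathLow] using ht
  | cons b L ih =>
    obtain ⟨h1, h2⟩ := ih h.1
    have h3 := h.2
    unfold pathMid at h3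
    rw [pathLow, List.length_cons]
    rcases Nat.lt_or_ge L.length d with hd | hd
    · have h4 : 2 ^ (d - L.length) = 2 * 2 ^ (d - (L.length + 1)) := by
        rw [← pow_succ']; congr 1; omega
      rw [h4] at h2 h3 ⊢
      cases b <;> simp at h3 ⊢ <;> omega
    · have h4 : d - L.length = 0 := by omega
      have h5 : d - (L.length + 1) = 0 := by omega
      rw [h4] at h2 h3 ⊢
      rw [h5]
      cases b <;> simp at h2 h3 ⊢ <;> omega

/-- With left turns always justified, a path first leaves the target by a wrong right turn. This
pushes the left end beyond `t`, and it never moves back while the path is extended. Testing the left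
end therefore detects every deviation, and no test of the right end is needed. -/
theorem LeftTurnsCorrect.lt_pathLow {t d : ℕ} {L : List Bool} (h : LeftTurnsCorrect t d L)
    (hL : ¬ OnTarget t d L) : t < pathLow d L := by
  induction L with
  | nil => exact absurd trivial hL
  | cons b L ih =>
    by_cases hT : OnTarget t d L
    · cases b with
      | false => exact absurd ⟨hT, by simpa using h.2 rfl⟩ hL
      | true =>
        have : ¬ pathMid d L ≤ t := fun h' => hL ⟨hT, by simpa using h'⟩
        simpa [pathLow, pathMid] using this
    · exact (ih h.1 hT).trans_le (pathLow_le_cons d b L)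

theorem pathScore_le_cons_add_one (t d : ℕ) (b : Bool) (L : List Bool) :
    pathScore t d L ≤ pathScore t d (b :: L) + 1 := by
  rw [pathScore]; split_ifs <;> omega

theorem pathScore_sub_one_le_tail (t d : ℕ) (L : List Bool) :
    pathScore t d L - 1 ≤ pathScore t d L.tail := by
  cases L with
  | nil => simp [pathScore]
  | cons b L => rw [pathScore, List.tail_cons]; split_ifs <;> omega

/-- A rejection is always right, so every left turn and every backtrack is justified. Only false
acceptance can cost a unit of the score. -/
theorem extendPath_spec {t d : ℕ} {test : ℕ → Bool} (htest : ∀ i ≤ t, test i = true)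
    {L : List Bool} (h : LeftTurnsCorrect t d L) :
    LeftTurnsCorrect t d (extendPath L (walkReply (test (pathLow d L)) (test (pathMid d L)))) ∧
    pathScore t d L - 1 ≤
      pathScore t d (extendPath L (walkReply (test (pathLow d L)) (test (pathMid d L)))) ∧
    (¬ TestError t d test L → pathScore t d L + 1 ≤
      pathScore t d (extendPath L (walkReply (test (pathLow d L)) (test (pathMid d L))))) := by
  have hfalse : ∀ i, test i = false → t < i := fun i hi => by
    by_contra hc
    rw [htest i (not_lt.1 hc)] at hi
    simp at hi
  cases h1 : test (pathLow d L) with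
  | false =>
    simp only [walkReply, Bool.false_eq_true, if_false, extendPath]
    refine ⟨?_, pathScore_sub_one_le_tail t d L, fun _ => ?_⟩
    · cases L with
      | nil => trivial
      | cons b L => exact h.1
    · have hlow := hfalse _ h1
      have hbad : ¬ OnTarget t d L := by
        intro hT
        have : ∀ L, OnTarget t d L → pathLow d L ≤ t := by
          intro L
          induction L with
          | nil => intro _; exact Nat.zero_le _
          | cons b L ih =>
            intro hT
            cases b with
            | false => simpa [pathLow] using ih hT.1
            | true => simpa [pathLow, pathMid] using hT.2.1 rfl
        exact absurd (this L hT) (not_le.2 hlow)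
      cases L with
      | nil => exact absurd trivial hbad
      | cons b L => rw [pathScore, if_neg hbad, List.tail_cons]; omega
  | true =>
    cases h2 : test (pathMid d L) with
    | false =>
      simp only [walkReply, Bool.false_eq_true, if_true, if_false, extendPath]
      have hmid := hfalse _ h2
      refine ⟨⟨h, fun _ => hmid⟩, ?_, fun he => ?_⟩
      · have := pathScore_le_cons_add_one t d false L
        omega
      · have hT : OnTarget t d L := by
          by_contra hc
          exact he (Or.inl ⟨h.lt_pathLow hc, h1⟩)
        rw [pathScore, if_pos ⟨hT, by simpa using hmid⟩]
    | true =>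
      simp only [walkReply, if_true, extendPath]
      refine ⟨⟨h, by simp⟩, ?_, fun he => ?_⟩
      · have := pathScore_le_cons_add_one t d true L
        omega
      · have hT : OnTarget t d L := by
          by_contra hc
          exact he (Or.inl ⟨h.lt_pathLow hc, h1⟩)
        have hmid : pathMid d L ≤ t := by
          by_contra hc
          exact he (Or.inr ⟨not_le.1 hc, h2⟩)
        rw [pathScore, if_pos ⟨hT, by simpa using hmid⟩]

/-- Paths may continue below depth `d`, where the interval width `2 ^ 0` halves to 0 and turns no
longer move the left end. If the last turn is off target, the rest has score at least `d + 1`, hence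
depth beyond `d`, and already sits at `t`. -/
theorem pathLow_eq_of_le_pathScore {t d : ℕ} (ht : t < 2 ^ d) {L : List Bool}
    (h : (d : ℤ) ≤ pathScore t d L) : pathLow d L = t := by
  induction L with
  | nil =>
    have := OnTarget.bounds ht (L := []) trivial
    have hd : d = 0 := by simpa [pathScore] using h
    subst hd
    simp at this
    omega
  | cons b L ih =>
    by_cases hT : OnTarget t d (b :: L)
    · rw [hT.pathScore_eq] at h
      have := hT.bounds ht
      rw [show d - (b :: L).length = 0 by omega, pow_zero] at this
      omega
    · rw [pathScore, if_neg hT] at h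
      have hlen := pathScore_le_length t d L
      rw [pathLow, ih (by omega), show d - L.length = 0 by omega]
      simp

-- The invariant is that the number of steps is at most the score plus twice the number of errors.
open Classical in
theorem pathLow_searchPath {t d : ℕ} (ht : t < 2 ^ d) {test : ℕ → ℕ → Bool}
    (htest : ∀ j, ∀ i ≤ t, test j i = true) (T : ℕ)
    (h : d + 2 * ((Finset.range T).filter
      fun j => TestError t d (test j) (searchPath d test j)).card ≤ T) :
    pathLow d (searchPath d test T) = t := by
  have key : ∀ T, LeftTurnsCorrect t d (searchPath d test T) ∧
      (T : ℤ) ≤ pathScore t d (searchPath d test T) + 2 * ((Finset.range T).filter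
      fun j => TestError t d (test j) (searchPath d test j)).card := by
    intro T
    induction T with
    | zero => simp [searchPath, LeftTurnsCorrect, pathScore]
    | succ T ih =>
      obtain ⟨h1, h2, h3⟩ := extendPath_spec (htest T) ih.1
      refine ⟨h1, ?_⟩
      rw [Finset.range_add_one, Finset.filter_insert, searchPath]
      split_ifs with he
      · rw [Finset.card_insert_of_notMem (by simp)]
        push_cast
        omega
      · have := h3 he
        push_cast
        omega
  have := (key T).2
  exact pathLow_eq_of_le_pathScore ht (by omega)

/-! ### Hashing with shared coins -/

open ProbabilityTheory

instance : IsProbabilityMeasure coinMeasure := by unfold coinMeasure; infer_instance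

/-- The events that depend only on the coins with index in `S`. -/
@[reducible]
def coinSigma (S : Set ℕ) : MeasurableSpace CoinString :=
  ⨆ i ∈ S, MeasurableSpace.comap (fun r : CoinString => r i) ⊤

theorem coinSigma_mono {S T : Set ℕ} (h : S ⊆ T) : coinSigma S ≤ coinSigma T :=
  biSup_mono fun _ hi => h hi

theorem coinSigma_le (S : Set ℕ) : coinSigma S ≤ MeasurableSpace.pi := by
  refine iSup₂_le fun i _ => ?_
  exact (measurable_pi_apply i).comap_le

theorem measurable_coin {S : Set ℕ} {i : ℕ} (hi : i ∈ S) :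
    Measurable[coinSigma S] fun r : CoinString => r i := by
  refine Measurable.mono (comap_measurable _) ?_ le_rfl
  exact le_biSup (fun i => MeasurableSpace.comap (fun r : CoinString => r i) ⊤) hi

theorem indep_coinSigma {S T : Set ℕ} (h : Disjoint S T) :
    Indep (coinSigma S) (coinSigma T) coinMeasure := by
  have h1 : iIndepFun (fun (i : ℕ) (r : CoinString) => r i) coinMeasure :=
    iIndepFun_infinitePi (X := fun _ b => b) fun _ => measurable_id
  exact indep_iSup_of_disjoint (fun i => (measurable_pi_apply i).comap_le)
    ((iIndepFun_iff_iIndep _ _ _).1 h1) h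

theorem coinMeasure_inter {S T : Set ℕ} (h : Disjoint S T) {E F : Set CoinString}
    (hE : MeasurableSet[coinSigma S] E) (hF : MeasurableSet[coinSigma T] F) :
    coinMeasure (E ∩ F) = coinMeasure E * coinMeasure F :=
  (Indep_iff _ _ _).1 (indep_coinSigma h) E F hE hF

theorem measurableSet_coin_eq {S : Set ℕ} {i : ℕ} (hi : i ∈ S) (b : Bool) :
    MeasurableSet[coinSigma S] {r : CoinString | r i = b} :=
  measurable_coin hi (measurableSet_singleton b)

theorem coinMeasure_coin_eq (i : ℕ) (b : Bool) : coinMeasure {r | r i = b} = 2⁻¹ := by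
  have h := (measurePreserving_eval_infinitePi
    (fun _ : ℕ => (PMF.uniformOfFintype Bool).toMeasure) i).measure_preimage
    (measurableSet_singleton b).nullMeasurableSet
  rw [PMF.toMeasure_apply_singleton _ _ (measurableSet_singleton b)] at h
  have hset : {r : CoinString | r i = b} = Function.eval i ⁻¹' ({b} : Set Bool) := rfl
  rw [hset, coinMeasure, h]
  simp

theorem coinMeasure_coins_eq {i j : ℕ} (hij : i ≠ j) :
    coinMeasure {r | r i = r j} = 2⁻¹ := by
  have hd : Disjoint ({i} : Set ℕ) {j} := by simpa using hij
  have hset : {r : CoinString | r i = r j} =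
      ({r | r i = true} ∩ {r | r j = true}) ∪ ({r | r i = false} ∩ {r | r j = false}) := by
    ext r
    simp only [Set.mem_ofPred_eq, Set.mem_union, Set.mem_inter_iff]
    cases r i <;> cases r j <;> simp
  have hm : ∀ i b, MeasurableSet {r : CoinString | r i = b} := fun i b =>
    coinSigma_le Set.univ _ (measurableSet_coin_eq (Set.mem_univ i) b)
  have hmul : ∀ b, coinMeasure ({r | r i = b} ∩ {r | r j = b}) = 2⁻¹ * 2⁻¹ := fun b => by
    rw [coinMeasure_inter hd (measurableSet_coin_eq (Set.mem_singleton i) b)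
        (measurableSet_coin_eq (Set.mem_singleton j) b),
      coinMeasure_coin_eq, coinMeasure_coin_eq]
  rw [hset, measure_union _ ((hm i _).inter (hm j _)), hmul, hmul, ← mul_add,
    ENNReal.inv_two_add_inv_two, mul_one]
  rw [Set.disjoint_left]
  rintro r ⟨h1, -⟩ ⟨h2, -⟩
  simp only [Set.mem_ofPred_eq] at h1 h2
  simp [h1] at h2

theorem coinMeasure_forall_coins_eq {a b : ℕ → ℕ} (ha : Function.Injective a)
    (hb : Function.Injective b) (hab : ∀ i j, a i ≠ b j) (n : ℕ) :
    coinMeasure {r | ∀ j < n, r (a j) = r (b j)} = 2⁻¹ ^ n := by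
  have hmeas : ∀ n, MeasurableSet[coinSigma {i | ∃ j < n, i = a j ∨ i = b j}]
      {r : CoinString | ∀ j < n, r (a j) = r (b j)} := by
    intro n
    have : {r : CoinString | ∀ j < n, r (a j) = r (b j)} =
        ⋂ j ∈ Set.Iio n, {r : CoinString | r (a j) = r (b j)} := by ext; simp
    rw [this]
    refine MeasurableSet.biInter (Set.to_countable _) fun j hj => ?_
    exact measurableSet_eq_fun (measurable_coin ⟨j, hj, Or.inl rfl⟩)
      (measurable_coin ⟨j, hj, Or.inr rfl⟩)
  induction n with
  | zero => simp
  | succ n ih =>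
    have hset : {r : CoinString | ∀ j < n + 1, r (a j) = r (b j)} =
        {r | ∀ j < n, r (a j) = r (b j)} ∩ {r | r (a n) = r (b n)} := by
      ext r
      simp only [Set.mem_ofPred_eq, Set.mem_inter_iff, Nat.lt_succ_iff_lt_or_eq, or_imp,
        forall_and, forall_eq]
    rw [hset, coinMeasure_inter (T := {a n, b n}) _ (hmeas n), ih, coinMeasure_coins_eq (hab n n),
      pow_succ]
    · exact measurableSet_eq_fun (measurable_coin (by simp)) (measurable_coin (by simp))
    · rw [Set.disjoint_left]
      rintro i ⟨j, hj, rfl | rfl⟩ (h | h)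
      · exact hj.ne (ha h)
      · exact hab _ _ h
      · exact hab _ _ h.symm
      · exact hj.ne (hb h)

/-- A hash value of `m` computed from the shared coins; different stages `k` use different coins.
The value `0` collides with no other. -/
def coinHash (K : ℕ) (r : CoinString) (k m : ℕ) : ℕ :=
  if m = 0 then 0 else Nat.ofBits (fun j : Fin K => r (Nat.pair k (Nat.pair m j))) + 1

theorem coinHash_zero (K : ℕ) (r : CoinString) (k : ℕ) : coinHash K r k 0 = 0 := if_pos rfl

theorem coinHash_ne_zero (K : ℕ) (r : CoinString) (k : ℕ) {m : ℕ} (hm : m ≠ 0) :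
    coinHash K r k m ≠ 0 := by simp [coinHash, hm]

theorem coinHash_le (K : ℕ) (r : CoinString) (k m : ℕ) : coinHash K r k m ≤ 2 ^ K := by
  unfold coinHash
  split_ifs
  · exact Nat.zero_le _
  · exact Nat.ofBits_lt_two_pow _

theorem measurable_coinHash (K : ℕ) {S : Set ℕ} {k : ℕ} (hS : ∀ i, Nat.pair k i ∈ S) (m : ℕ) :
    Measurable[coinSigma S] fun r => coinHash K r k m := by
  unfold coinHash
  split_ifs
  · exact measurable_const
  · have h1 : Measurable[coinSigma S]
        fun (r : CoinString) (j : Fin K) => r (Nat.pair k (Nat.pair m j)) :=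
      @measurable_pi_lambda _ _ _ (coinSigma S) _ _ fun j => measurable_coin (hS _)
    exact (measurable_of_countable fun f : Fin K → Bool => Nat.ofBits f + 1).comp h1

theorem coinMeasure_coinHash_eq_le (K k : ℕ) {m m' : ℕ} (h : m ≠ m') :
    coinMeasure {r | coinHash K r k m = coinHash K r k m'} ≤ 2⁻¹ ^ K := by
  by_cases hm : m = 0
  · subst hm
    have : {r | coinHash K r k 0 = coinHash K r k m'} = ∅ := by
      ext r
      simpa [coinHash_zero] using (coinHash_ne_zero K r k h.symm).symm
    simp [this]
  by_cases hm' : m' = 0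
  · subst hm'
    have : {r | coinHash K r k m = coinHash K r k 0} = ∅ := by
      ext r
      simpa [coinHash_zero] using coinHash_ne_zero K r k h
    simp [this]
  rw [← coinMeasure_forall_coins_eq (a := fun j => Nat.pair k (Nat.pair m j))
    (b := fun j => Nat.pair k (Nat.pair m' j)) (fun i j hij => by simpa using hij)
    (fun i j hij => by simpa using hij) (fun i j hij => h (by simp at hij; exact hij.1)) K]
  refine measure_mono fun r hr j hj => ?_
  simp only [Set.mem_ofPred_eq, coinHash, hm, hm', if_false, Nat.add_right_cancel_iff] at hr
  have h1 := congrArg (fun n => n.testBit j) hr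
  simpa only [Nat.testBit_ofBits_lt _ _ hj] using h1

/-- The comparison of two hash values at a stage. -/
def hashTest (K : ℕ) (r : CoinString) (f g : ℕ → ℕ) (k i : ℕ) : Bool :=
  decide (coinHash K r k (f i) = coinHash K r k (g i))

theorem hashTest_of_eq (K : ℕ) (r : CoinString) {f g : ℕ → ℕ} (k : ℕ) {i : ℕ} (h : f i = g i) :
    hashTest K r f g k i = true := by simp [hashTest, h]

theorem measurable_hashTest (K : ℕ) (f g : ℕ → ℕ) {S : Set ℕ} {k : ℕ}
    (hS : ∀ i, Nat.pair k i ∈ S) (i : ℕ) :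
    Measurable[coinSigma S] fun r => hashTest K r f g k i := by
  have := (measurable_coinHash K hS (f i)).prodMk (measurable_coinHash K hS (g i))
  exact (measurable_of_countable fun p : ℕ × ℕ => decide (p.1 = p.2)).comp this

theorem coinMeasure_hashTest_le (K : ℕ) {f g : ℕ → ℕ} (k : ℕ) {i : ℕ} (h : f i ≠ g i) :
    coinMeasure {r | hashTest K r f g k i = true} ≤ 2⁻¹ ^ K := by
  simpa [hashTest] using coinMeasure_coinHash_eq_le K k h

/-! ### The error probability of the search -/

section Search

variable (K d : ℕ) (f g : ℕ → ℕ)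

/-- The path of the binary search with hash comparisons. -/
def hashPath (r : CoinString) (j : ℕ) : List Bool :=
  searchPath d (fun j => hashTest K r f g (2 * j + 1)) j

/-- The path before step `j` reads only stages below `2 * j`, which makes it independent of the
coins of stage `2 * j + 1`. Even stages are left to galloping. -/
theorem measurableSet_hashPath_eq (j : ℕ) : ∀ L,
    MeasurableSet[coinSigma {i | i.unpair.1 < 2 * j}] {r | hashPath K d f g r j = L} := by
  induction j with
  | zero =>
    intro L
    by_cases hL : [] = L
    · simp [hashPath, searchPath, hL]
    · simp [hashPath, searchPath, hL]
  | succ j ih =>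
    intro L
    have hset : {r | hashPath K d f g r (j + 1) = L} = ⋃ L', {r | hashPath K d f g r j = L'} ∩
        {r | extendPath L' (walkReply (hashTest K r f g (2 * j + 1) (pathLow d L'))
          (hashTest K r f g (2 * j + 1) (pathMid d L'))) = L} := by
      ext r
      simp [hashPath, searchPath]
    rw [hset]
    refine MeasurableSet.iUnion fun L' => ?_
    refine MeasurableSet.inter (coinSigma_mono (fun i hi => ?_) _ (ih L')) ?_
    · simp only [Set.mem_ofPred_eq] at hi ⊢; omega
    · have hS : ∀ i, Nat.pair (2 * j + 1) i ∈ {i : ℕ | i.unpair.1 < 2 * (j + 1)} := by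
        intro i; simp; omega
      have := (measurable_hashTest K f g hS (pathLow d L')).prodMk
        (measurable_hashTest K f g hS (pathMid d L'))
      exact this (MeasurableSet.of_discrete
        (s := {p : Bool × Bool | extendPath L' (walkReply p.1 p.2) = L}))

variable {f g} {t : ℕ}

/-- The event that a test of the search step `j` errs. -/
def searchError (f g : ℕ → ℕ) (t j : ℕ) : Set CoinString :=
  {r | TestError t d (hashTest K r f g (2 * j + 1)) (hashPath K d f g r j)}

theorem measurableSet_testError (f g : ℕ → ℕ) (t j : ℕ) (L : List Bool) :
    MeasurableSet[coinSigma {i | i.unpair.1 = 2 * j + 1}]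
      {r | TestError t d (hashTest K r f g (2 * j + 1)) L} := by
  have hS : ∀ i, Nat.pair (2 * j + 1) i ∈ {i : ℕ | i.unpair.1 = 2 * j + 1} := by simp
  have := (measurable_hashTest K f g hS (pathLow d L)).prodMk
    (measurable_hashTest K f g hS (pathMid d L))
  exact this (MeasurableSet.of_discrete (s := {p : Bool × Bool |
    (t < pathLow d L ∧ p.1 = true) ∨ (t < pathMid d L ∧ p.2 = true)}))

theorem searchError_eq (f g : ℕ → ℕ) (t j : ℕ) : searchError K d f g t j =
    ⋃ L, {r | hashPath K d f g r j = L} ∩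
      {r | TestError t d (hashTest K r f g (2 * j + 1)) L} := by
  ext r
  simp [searchError]

theorem measurableSet_searchError (f g : ℕ → ℕ) (t j : ℕ) :
    MeasurableSet (searchError K d f g t j) := by
  rw [searchError_eq]
  exact MeasurableSet.iUnion fun L =>
    (coinSigma_le _ _ (measurableSet_hashPath_eq K d f g j L)).inter
      (coinSigma_le _ _ (measurableSet_testError K d f g t j L))

theorem coinMeasure_testError_le (hfg : ∀ i, f i = g i ↔ i ≤ t) (j : ℕ) (L : List Bool) :
    coinMeasure {r | TestError t d (hashTest K r f g (2 * j + 1)) L} ≤ 2 * 2⁻¹ ^ K := by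
  have hcase : ∀ i, coinMeasure {r | t < i ∧ hashTest K r f g (2 * j + 1) i = true} ≤
      2⁻¹ ^ K := by
    intro i
    by_cases hi : t < i
    · simpa [hi] using coinMeasure_hashTest_le K (2 * j + 1)
        (fun h => absurd ((hfg i).1 h) (not_le.2 hi))
    · simp [hi]
  rw [two_mul (2⁻¹ ^ K : ENNReal)]
  have hset : {r | TestError t d (hashTest K r f g (2 * j + 1)) L} =
      {r | t < pathLow d L ∧ hashTest K r f g (2 * j + 1) (pathLow d L) = true} ∪
      {r | t < pathMid d L ∧ hashTest K r f g (2 * j + 1) (pathMid d L) = true} := rfl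
  rw [hset]
  exact (measure_union_le _ _).trans (add_le_add (hcase _) (hcase _))

/-- The positions tested depend on earlier coins, so the event is split according to the path; for
each fixed path the fresh coins give the bound independently of it. -/
theorem coinMeasure_searchError_le (hfg : ∀ i, f i = g i ↔ i ≤ t) (j : ℕ) :
    coinMeasure (searchError K d f g t j) ≤ 2 * 2⁻¹ ^ K := by
  have hd : Disjoint {i : ℕ | i.unpair.1 < 2 * j} {i : ℕ | i.unpair.1 = 2 * j + 1} := by
    rw [Set.disjoint_left]
    intro i hi hi'
    simp only [Set.mem_ofPred_eq] at hi hi'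
    omega
  rw [searchError_eq]
  refine (measure_iUnion_le _).trans ?_
  calc ∑' L, coinMeasure ({r | hashPath K d f g r j = L} ∩
        {r | TestError t d (hashTest K r f g (2 * j + 1)) L})
      ≤ ∑' L, coinMeasure {r | hashPath K d f g r j = L} * (2 * 2⁻¹ ^ K) := by
        refine ENNReal.tsum_le_tsum fun L => ?_
        rw [coinMeasure_inter hd (measurableSet_hashPath_eq K d f g j L)
          (measurableSet_testError K d f g t j L)]
        gcongr
        exact coinMeasure_testError_le K d hfg j L
    _ = coinMeasure (⋃ L, {r | hashPath K d f g r j = L}) * (2 * 2⁻¹ ^ K) := by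
        rw [ENNReal.tsum_mul_right, measure_iUnion]
        · intro L L' hLL'
          rw [Function.onFun, Set.disjoint_left]
          exact fun r h1 h2 => hLL' (h1.symm.trans h2)
        · exact fun L => coinSigma_le _ _ (measurableSet_hashPath_eq K d f g j L)
    _ ≤ 1 * (2 * 2⁻¹ ^ K) := by gcongr; exact prob_le_one
    _ = _ := one_mul _

/-- Markov's inequality for the number of errors: failure needs at least a quarter of the `2 * (d +
1)` steps to err, and each errs with probability at most `2 * 2⁻¹ ^ K`. The bound does not depend on
`d`, and independence between the errors is not needed. -/
theorem coinMeasure_pathLow_ne_le (hfg : ∀ i, f i = g i ↔ i ≤ t) (ht : t < 2 ^ d) :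
    coinMeasure {r | pathLow d (hashPath K d f g r (2 * (d + 1))) ≠ t} ≤ 8 * 2⁻¹ ^ K := by
  classical
  set T := 2 * (d + 1) with hT
  let F : CoinString → ENNReal := fun r =>
    ∑ j ∈ Finset.range T, (searchError K d f g t j).indicator 1 r
  have hF : Measurable F := Finset.measurable_sum _ fun j _ =>
    measurable_one.indicator (measurableSet_searchError K d f g t j)
  have hint : ∫⁻ r, F r ∂coinMeasure ≤ T * (2 * 2⁻¹ ^ K) := by
    rw [lintegral_finsetSum _ fun j _ =>
      measurable_one.indicator (measurableSet_searchError K d f g t j)]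
    calc _ ≤ ∑ j ∈ Finset.range T, (2 * 2⁻¹ ^ K : ENNReal) := by
          refine Finset.sum_le_sum fun j _ => ?_
          rw [lintegral_indicator_one (measurableSet_searchError K d f g t j)]
          exact coinMeasure_searchError_le K d hfg j
      _ = _ := by simp
  have hcard : ∀ r, F r = ((Finset.range T).filter fun j =>
      TestError t d (hashTest K r f g (2 * j + 1)) (hashPath K d f g r j)).card := by
    intro r
    simp [F, Set.indicator_apply, searchError]
  have hsub : {r | pathLow d (hashPath K d f g r T) ≠ t} ⊆ {r | (T : ENNReal) ≤ 4 * F r} := by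
    intro r hr
    rw [Set.mem_ofPred_eq, hcard]
    by_contra hlt
    rw [not_le] at hlt
    have hlt' : 4 * ((Finset.range T).filter fun j =>
      TestError t d (hashTest K r f g (2 * j + 1)) (hashPath K d f g r j)).card < T := by
        exact_mod_cast hlt
    refine hr (pathLow_searchPath (test := fun j => hashTest K r f g (2 * j + 1)) ht
      (fun j i hi => hashTest_of_eq K r _ ((hfg i).2 hi)) T ?_)
    change d + 2 * ((Finset.range T).filter fun j =>
      TestError t d (hashTest K r f g (2 * j + 1)) (hashPath K d f g r j)).card ≤ T
    omega
  have hmarkov := mul_meas_ge_le_lintegral (μ := coinMeasure) (hF.const_mul 4) (T : ENNReal)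
  rw [lintegral_const_mul _ hF] at hmarkov
  have hT0 : (T : ENNReal) ≠ 0 := by simp [hT]
  refine (measure_mono hsub).trans ?_
  rw [← ENNReal.mul_le_mul_iff_right hT0 (by simp)]
  refine hmarkov.trans ((mul_le_mul_right hint 4).trans (le_of_eq ?_))
  ring

/-- Outside an event of small probability the test of the first power of two beyond `t` fails and
the search in the range that it bounds finds `t`. -/
theorem coinMeasure_search_le (hfg : ∀ i, f i = g i ↔ i ≤ t) :
    coinMeasure {r | ¬ (hashTest K r f g (2 * t.size) (2 ^ t.size) = false ∧
      pathLow t.size (hashPath K t.size f g r (2 * (t.size + 1))) = t)} ≤ 9 * 2⁻¹ ^ K := by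
  have h1 := coinMeasure_hashTest_le K (2 * t.size)
    (fun h => absurd ((hfg (2 ^ t.size)).1 h) (not_le.2 (Nat.lt_size_self t)))
  have h2 := coinMeasure_pathLow_ne_le K t.size hfg (Nat.lt_size_self t)
  calc _ ≤ coinMeasure ({r | hashTest K r f g (2 * t.size) (2 ^ t.size) = true} ∪
        {r | pathLow t.size (hashPath K t.size f g r (2 * (t.size + 1))) ≠ t}) := by
        refine measure_mono fun r hr => ?_
        simp only [Set.mem_ofPred_eq, not_and_or, Bool.not_eq_false] at hr
        exact hr
    _ ≤ 2⁻¹ ^ K + 8 * 2⁻¹ ^ K := (measure_union_le _ _).trans (add_le_add h1 h2)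
    _ = _ := by ring

end Search

/-! ### The protocols for the longest common prefix -/

/-- The states of the protocols. The search for the last common phrase boundary uses the first four,
the two ways to compute the smaller one of two match ends use `race`, `raceReply` and
`scale`, `capped`, `finish`. -/
inductive LcpState where
  | gallop (d : ℕ)
  | gallopReply (d m : ℕ)
  | walk (d j : ℕ) (L : List Bool)
  | walkReply (d j : ℕ) (L : List Bool) (m : ℕ)
  | source (i : ℕ)
  | race (i s j : ℕ)
  | raceReply (i s j m : ℕ)
  | scale (i s : ℕ)
  | capped (i s j : ℕ)
  | finish (i s m : ℕ)
  | done (n : ℕ)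

section Protocol

variable {α : Type*} [DecidableEq α]

/-- The number that represents the first `i` phrases of a string; it is `c` if there are fewer. -/
def phraseKey (enc : List (List α) → ℕ) (c : ℕ) (S : List α) (i : ℕ) : ℕ :=
  if i ≤ (lz77Parse S).length then enc ((lz77Parse S).take i) + 2 else c

/-- The distinct defaults 0 and 1 and the shift by 2 make the keys differ as soon as either string
has too few phrases. -/
theorem phraseKey_eq_iff {enc : List (List α) → ℕ} (henc : Function.Injective enc)
    {A B : List α} {i : ℕ} : phraseKey enc 0 A i = phraseKey enc 1 B i ↔ AgreeOnPhrases A B i := by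
  unfold phraseKey AgreeOnPhrases
  split_ifs with h1 h2 h2 <;> simp [h1, h2, henc.eq_iff]

/-- The messages of the protocol with `K`-bit hash values and shared coins `r`. -/
noncomputable def lcpLabel (enc : List (List α) → ℕ) (K : ℕ) (r : CoinString) :
    LcpState → MessageLabel (List α) (List α) ℕ
  | .gallop d => .alice fun A => coinHash K r (2 * d) (phraseKey enc 0 A (2 ^ d))
  | .gallopReply d m => .bob fun B =>
      if m = coinHash K r (2 * d) (phraseKey enc 1 B (2 ^ d)) then 1 else 0
  | .walk d j L => .alice fun A =>
      Nat.pair (coinHash K r (2 * j + 1) (phraseKey enc 0 A (pathLow d L)))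
        (coinHash K r (2 * j + 1) (phraseKey enc 0 A (pathMid d L)))
  | .walkReply d j L m => .bob fun B => walkReply
      (decide (m.unpair.1 = coinHash K r (2 * j + 1) (phraseKey enc 1 B (pathLow d L))))
      (decide (m.unpair.2 = coinHash K r (2 * j + 1) (phraseKey enc 1 B (pathMid d L))))
  | .source i => .alice fun A => bestSource A i
  | .race i s j => .alice fun A => if matchEnd A i s < 2 ^ 2 ^ j then matchEnd A i s + 1 else 0
  | .raceReply i s j m => .bob fun B =>
      if m = 0 then (if matchEnd B i s < 2 ^ 2 ^ j then matchEnd B i s + 1 else 0)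
      else min (m - 1) (matchEnd B i s) + 1
  | .scale i s => .alice fun A => (matchEnd A i s).size.size
  | .capped i s j => .bob fun B => if matchEnd B i s < 2 ^ 2 ^ j then matchEnd B i s + 1 else 0
  | .finish i s m => .alice fun A =>
      if m = 0 then matchEnd A i s else min (matchEnd A i s) (m - 1)
  | .done n => .leaf n

/-- The transitions of the protocol; the flag chooses between the race through the doubly
exponential scales and the direct transmission of the scale. -/
def lcpNext (flag : Bool) : LcpState → ℕ → LcpState
  | .gallop d, m => .gallopReply d m
  | .gallopReply d _, m => if m = 0 then .walk d 0 [] else .gallop (d + 1)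
  | .walk d j L, m => .walkReply d j L m
  | .walkReply d j L _, m =>
      if j + 1 < 2 * (d + 1) then .walk d (j + 1) (extendPath L m)
      else .source (pathLow d (extendPath L m))
  | .source i, m => if flag then .race i m 0 else .scale i m
  | .race i s j, m => .raceReply i s j m
  | .raceReply i s j _, m => if m = 0 then .race i s (j + 1) else .done (m - 1)
  | .scale i s, m => .capped i s m
  | .capped i s _, m => .finish i s m
  | .finish _ _ _, m => .done m
  | .done n, _ => .done n

/-- The protocol with `K`-bit hash values and shared coins `r`. -/
noncomputable def lcpProtocol (enc : List (List α) → ℕ) (K : ℕ) (flag : Bool) (r : CoinString) :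
    MessageProtocol (List α) (List α) ℕ where
  State := LcpState
  root := .gallop 0
  label := lcpLabel enc K r
  next := lcpNext flag

/-- From state `s` the protocol stops with output `z` after at most `k` messages and `c` bits. -/
def LcpRun (enc : List (List α) → ℕ) (K : ℕ) (flag : Bool) (r : CoinString) (A B : List α)
    (s : LcpState) (z k c : ℕ) : Prop :=
  (lcpProtocol enc K flag r).RunLE A B s z k c

variable {enc : List (List α) → ℕ} {K : ℕ} {flag : Bool} {r : CoinString} {A B : List α}

theorem LcpRun.mono {s : LcpState} {z k c k' c' : ℕ} (h : LcpRun enc K flag r A B s z k c)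
    (hk : k ≤ k') (hc : c ≤ c') : LcpRun enc K flag r A B s z k' c' :=
  MessageProtocol.RunLE.mono h hk hc

theorem LcpRun.done (z : ℕ) : LcpRun enc K flag r A B (.done z) z 0 0 :=
  MessageProtocol.RunLE.leaf rfl

theorem LcpRun.alice {s : LcpState} {z k c : ℕ} {f : List α → ℕ}
    (hs : lcpLabel enc K r s = .alice f) (h : LcpRun enc K flag r A B (lcpNext flag s (f A)) z k c) :
    LcpRun enc K flag r A B s z (k + 1) (c + (2 * (f A).size + 1)) :=
  MessageProtocol.RunLE.alice hs h

theorem LcpRun.bob {s : LcpState} {z k c : ℕ} {f : List α → ℕ}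
    (hs : lcpLabel enc K r s = .bob f) (h : LcpRun enc K flag r A B (lcpNext flag s (f B)) z k c) :
    LcpRun enc K flag r A B s z (k + 1) (c + (2 * (f B).size + 1)) :=
  MessageProtocol.RunLE.bob hs h

theorem size_coinHash_le (K : ℕ) (r : CoinString) (k m : ℕ) : (coinHash K r k m).size ≤ K + 1 := by
  rw [Nat.size_le]
  exact (coinHash_le K r k m).trans_lt (Nat.pow_lt_pow_right (by norm_num) (Nat.lt_succ_self K))

theorem size_pair_le {K m n : ℕ} (hm : m ≤ 2 ^ K) (hn : n ≤ 2 ^ K) :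
    (Nat.pair m n).size ≤ 2 * K + 2 := by
  rw [Nat.size_le]
  refine (Nat.pair_lt_max_add_one_sq m n).trans_le ?_
  have h1 : max m n + 1 ≤ 2 ^ (K + 1) := by
    have : max m n ≤ 2 ^ K := max_le hm hn
    have := Nat.one_le_two_pow (n := K)
    rw [pow_succ]
    omega
  calc (max m n + 1) ^ 2 ≤ (2 ^ (K + 1)) ^ 2 := Nat.pow_le_pow_left h1 2
    _ = 2 ^ (2 * K + 2) := by rw [← pow_mul]; congr 1; ring

theorem size_le_two {n : ℕ} (h : n ≤ 2) : n.size ≤ 2 := by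
  rw [Nat.size_le]; omega

theorem walkReply_le (a b : Bool) : walkReply a b ≤ 2 := by
  cases a <;> cases b <;> simp [walkReply]

theorem size_succ_le (n : ℕ) : (n + 1).size ≤ n.size + 1 := by
  rw [Nat.size_le, pow_succ]
  have := Nat.lt_size_self n
  omega

theorem two_pow_size_le (n : ℕ) : 2 ^ n.size ≤ 2 * n + 1 := by
  rcases h : n.size with _ | m
  · simp
  · have := Nat.lt_size.1 (show m < n.size by omega)
    rw [pow_succ]
    omega

theorem lt_two_pow_two_pow_size_size (n : ℕ) : n < 2 ^ 2 ^ n.size.size :=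
  (Nat.lt_size_self n).trans (Nat.pow_lt_pow_right (by norm_num) (Nat.lt_size_self _))

theorem lcpProtocol_walk {z k c d : ℕ}
    (h : LcpRun enc K flag r A B (.source (pathLow d
      (hashPath K d (phraseKey enc 0 A) (phraseKey enc 1 B) r (2 * (d + 1))))) z k c) (n : ℕ) :
    ∀ j, j + (n + 1) = 2 * (d + 1) → LcpRun enc K flag r A B
      (.walk d j (hashPath K d (phraseKey enc 0 A) (phraseKey enc 1 B) r j)) z
      (k + 2 * (n + 1)) (c + (n + 1) * (4 * K + 10)) := by
  have step : ∀ j z k c, LcpRun enc K flag r A B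
      (if j + 1 < 2 * (d + 1) then
        .walk d (j + 1) (hashPath K d (phraseKey enc 0 A) (phraseKey enc 1 B) r (j + 1))
        else .source (pathLow d
          (hashPath K d (phraseKey enc 0 A) (phraseKey enc 1 B) r (j + 1)))) z k c →
      LcpRun enc K flag r A B
        (.walk d j (hashPath K d (phraseKey enc 0 A) (phraseKey enc 1 B) r j)) z
        (k + 2) (c + (4 * K + 10)) := by
    intro j z k c hrun
    set L := hashPath K d (phraseKey enc 0 A) (phraseKey enc 1 B) r j with hL
    have hL' : hashPath K d (phraseKey enc 0 A) (phraseKey enc 1 B) r (j + 1) =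
        extendPath L (walkReply
          (hashTest K r (phraseKey enc 0 A) (phraseKey enc 1 B) (2 * j + 1) (pathLow d L))
          (hashTest K r (phraseKey enc 0 A) (phraseKey enc 1 B) (2 * j + 1) (pathMid d L))) := rfl
    rw [hL'] at hrun
    refine LcpRun.mono (LcpRun.alice (s := LcpState.walk d j L) rfl
      (LcpRun.bob (s := LcpState.walkReply d j L _) rfl (k := k) (c := c) ?_)) (by omega) ?_
    · simp only [Nat.unpair_pair]
      exact hrun
    -- Two hash values paired cost at most `4 * K + 5` bits, and the reply, which is at most 2,
    -- costs at most 5.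
    · have h1 := size_pair_le
        (coinHash_le K r (2 * j + 1) (phraseKey enc 0 A (pathLow d L)))
        (coinHash_le K r (2 * j + 1) (phraseKey enc 0 A (pathMid d L)))
      refine (Nat.add_le_add (Nat.add_le_add_left (Nat.add_le_add_right
        (Nat.mul_le_mul_left 2 (size_le_two (walkReply_le _ _))) 1) _) (Nat.add_le_add_right
        (Nat.mul_le_mul_left 2 h1) 1)).trans ?_
      omega
  induction n with
  | zero =>
    intro j hj
    refine (step j z k c ?_).mono (by omega) (by omega)
    rw [if_neg (by omega), show j + 1 = 2 * (d + 1) by omega]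
    exact h
  | succ n ih =>
    intro j hj
    refine (step j z (k + 2 * (n + 1)) (c + (n + 1) * (4 * K + 10)) ?_).mono
      (le_of_eq ?_) (le_of_eq ?_)
    · rw [if_pos (by omega)]
      exact ih (j + 1) (by omega)
    · ring
    · ring

theorem lcpProtocol_search {z k c D : ℕ}
    (hlt : ∀ d < D, hashTest K r (phraseKey enc 0 A) (phraseKey enc 1 B) (2 * d) (2 ^ d) = true)
    (hD : hashTest K r (phraseKey enc 0 A) (phraseKey enc 1 B) (2 * D) (2 ^ D) = false)
    (h : LcpRun enc K flag r A B (.source (pathLow D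
      (hashPath K D (phraseKey enc 0 A) (phraseKey enc 1 B) r (2 * (D + 1))))) z k c) :
    LcpRun enc K flag r A B (.gallop 0) z (k + 6 * (D + 1))
      (c + 3 * (D + 1) * (4 * K + 10)) := by
  have step : ∀ d k c, LcpRun enc K flag r A B
      (if hashTest K r (phraseKey enc 0 A) (phraseKey enc 1 B) (2 * d) (2 ^ d) = true then
        .gallop (d + 1) else .walk d 0 []) z k c →
      LcpRun enc K flag r A B (.gallop d) z (k + 2) (c + (4 * K + 10)) := by
    intro d k c hrun
    refine LcpRun.mono (LcpRun.alice (s := LcpState.gallop d) rfl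
      (LcpRun.bob (s := LcpState.gallopReply d _) rfl (k := k) (c := c) ?_)) (by omega) ?_
    · unfold hashTest at hrun
      by_cases he : coinHash K r (2 * d) (phraseKey enc 0 A (2 ^ d)) =
          coinHash K r (2 * d) (phraseKey enc 1 B (2 ^ d))
      · simp only [he, decide_true, if_true] at hrun ⊢
        exact hrun
      · simp only [he, decide_false, Bool.false_eq_true, if_false] at hrun ⊢
        exact hrun
    · have h1 := size_coinHash_le K r (2 * d) (phraseKey enc 0 A (2 ^ d))
      refine (Nat.add_le_add (Nat.add_le_add_left (Nat.add_le_add_right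
        (Nat.mul_le_mul_left 2 (size_le_two ?_)) 1) _) (Nat.add_le_add_right
        (Nat.mul_le_mul_left 2 h1) 1)).trans ?_
      · split_ifs <;> omega
      · omega
  have hwalk := lcpProtocol_walk h (2 * D + 1) 0 (by ring)
  have hgallop : ∀ n d, d + n = D → LcpRun enc K flag r A B (.gallop d) z
      (k + 4 * (D + 1) + 2 * (n + 1)) (c + 2 * (D + 1) * (4 * K + 10) + (n + 1) * (4 * K + 10)) := by
    intro n
    induction n with
    | zero =>
      intro d hd
      obtain rfl : d = D := hd
      refine (step d (k + 2 * (2 * d + 1 + 1)) (c + (2 * d + 1 + 1) * (4 * K + 10)) ?_).mono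
        (le_of_eq (by ring)) (le_of_eq (by ring))
      rw [hD, if_neg (by simp)]
      exact hwalk
    | succ n ih =>
      intro d hd
      refine (step d (k + 4 * (D + 1) + 2 * (n + 1))
        (c + 2 * (D + 1) * (4 * K + 10) + (n + 1) * (4 * K + 10)) ?_).mono
        (le_of_eq ?_) (le_of_eq ?_)
      · rw [if_pos (hlt d (by omega))]
        exact ih (d + 1) (by omega)
      · ring
      · ring
  exact (hgallop D 0 (Nat.zero_add D)).mono (le_of_eq (by ring)) (le_of_eq (by ring))

/-- At a scale below both numbers each party sends only the one-bit code of 0. Numbers are sent at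
the first scale that exceeds the minimum, so long messages are paid for once. If Alice's number is
too large there, Bob's is the minimum. -/
theorem lcpProtocol_race {i s q : ℕ} (hq : q = min (matchEnd A i s) (matchEnd B i s)) (n : ℕ) :
    ∀ j, q < 2 ^ 2 ^ (j + n) → LcpRun enc K flag r A B (.race i s j) q
      (2 * (n + 1)) (2 * n + (4 * 2 ^ (j + n) + 6)) := by
  have hsize : ∀ a j, a < 2 ^ 2 ^ j → (a + 1).size ≤ 2 ^ j + 1 := fun a j ha =>
    (size_succ_le a).trans (Nat.add_le_add_right (Nat.size_le.2 ha) 1)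
  have hfinal : ∀ j, q < 2 ^ 2 ^ j → LcpRun enc K flag r A B (.race i s j) q 2
      (4 * 2 ^ j + 6) := by
    intro j hj
    refine LcpRun.mono (LcpRun.alice (s := LcpState.race i s j) rfl
      (LcpRun.bob (s := LcpState.raceReply i s j _) rfl (k := 0) (c := 0) ?_)) le_rfl ?_
    · by_cases ha : matchEnd A i s < 2 ^ 2 ^ j
      · simp only [lcpNext, ha, if_true, Nat.add_one_ne_zero, if_false, Nat.add_sub_cancel,
          ← hq]
        exact LcpRun.done _
      · have hb : q = matchEnd B i s := by omega
        simp only [lcpNext, ha, if_true, if_false, ← hb, hj, Nat.add_one_ne_zero,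
          Nat.add_sub_cancel]
        exact LcpRun.done _
    · by_cases ha : matchEnd A i s < 2 ^ 2 ^ j
      · simp only [ha, if_true, Nat.add_one_ne_zero, if_false, Nat.add_sub_cancel, ← hq]
        have h1 := hsize _ _ ha
        have h2 := hsize _ _ hj
        omega
      · have hb : q = matchEnd B i s := by omega
        simp only [ha, if_true, if_false, ← hb, hj, Nat.size_zero]
        have h2 := hsize _ _ hj
        omega
  induction n with
  | zero =>
    intro j hj
    exact (hfinal j hj).mono (by omega) (by simp)
  | succ n ih =>
    intro j hj
    by_cases hj' : q < 2 ^ 2 ^ j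
    · refine (hfinal j hj').mono (by omega) ?_
      have := Nat.pow_le_pow_right (show 0 < 2 by norm_num) (show j ≤ j + (n + 1) by omega)
      omega
    · have hrun := ih (j + 1) (by rwa [show j + 1 + n = j + (n + 1) by ring])
      rw [show j + 1 + n = j + (n + 1) by ring] at hrun
      have ha : ¬ matchEnd A i s < 2 ^ 2 ^ j := by omega
      have hb : ¬ matchEnd B i s < 2 ^ 2 ^ j := by omega
      refine LcpRun.mono (LcpRun.alice (s := LcpState.race i s j) rfl
        (LcpRun.bob (s := LcpState.raceReply i s j _) rfl (k := 2 * (n + 1))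
          (c := 2 * n + (4 * 2 ^ (j + (n + 1)) + 6)) ?_)) (by omega) ?_
      · simp only [lcpNext, ha, hb, if_true, if_false]
        exact hrun
      · simp only [ha, hb, if_true, if_false, Nat.size_zero]
        omega

/-- Bob's number is cheap to send if it is the minimum. Otherwise he sends it only below the cap,
whose length is at most about twice that of Alice's number, which is then the minimum. -/
theorem lcpProtocol_scale {i s q : ℕ} (hq : q = min (matchEnd A i s) (matchEnd B i s)) :
    LcpRun enc K flag r A B (.scale i s) q 3
      (2 * (matchEnd A i s).size.size.size + 6 * q.size + 8) := by
  set a := matchEnd A i s with ha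
  set b := matchEnd B i s with hb
  have hlt := lt_two_pow_two_pow_size_size a
  refine LcpRun.mono (LcpRun.alice (s := LcpState.scale i s) rfl
    (LcpRun.bob (s := LcpState.capped i s _) rfl
      (LcpRun.alice (s := LcpState.finish i s _) rfl (k := 0) (c := 0) ?_))) le_rfl ?_
  · simp only [lcpNext, ← ha, ← hb]
    by_cases hb' : b < 2 ^ 2 ^ a.size.size
    · simp only [hb', if_true, Nat.add_one_ne_zero, if_false, Nat.add_sub_cancel, ← hq]
      exact LcpRun.done _
    · have : q = a := by omega
      simp only [hb', if_false, if_true]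
      rw [this]
      exact LcpRun.done _
  · simp only [← ha, ← hb]
    by_cases hb' : b < 2 ^ 2 ^ a.size.size
    · simp only [hb', if_true, Nat.add_one_ne_zero, if_false, Nat.add_sub_cancel, ← hq]
      have h1 : (b + 1).size ≤ 2 * q.size + 2 := by
        rcases le_total b a with h | h
        · have := size_succ_le b
          rw [show q = b by omega]
          omega
        · have h2 := (size_succ_le b).trans (Nat.add_le_add_right (Nat.size_le.2 hb') 1)
          have h3 := two_pow_size_le a.size
          rw [show q = a by omega]
          omega
      omega
    · have : q = a := by omega
      simp only [hb', if_false, if_true, Nat.size_zero, this]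
      omega

/-- The number of messages that follow the search when the longest common prefix has length `l`. -/
def finalRounds (flag : Bool) (l : ℕ) : ℕ :=
  if flag then 2 * (l.size.size + 1) + 1 else 4

/-- The number of bits that follow the search, if Alice's source and match end are `s` and `a`, and
`l` is the smaller one of the match ends. -/
def finalBits (flag : Bool) (s a l : ℕ) : ℕ :=
  (if flag then 2 * l.size.size + (4 * 2 ^ l.size.size + 6)
    else 2 * a.size.size.size + 6 * l.size + 8) + (2 * s.size + 1)

theorem lcpProtocol_source {i q : ℕ}
    (hq : q = min (matchEnd A i (bestSource A i)) (matchEnd B i (bestSource A i))) :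
    LcpRun enc K flag r A B (.source i) q (finalRounds flag q)
      (finalBits flag (bestSource A i) (matchEnd A i (bestSource A i)) q) := by
  unfold finalRounds finalBits
  cases flag with
  | true =>
    have hq' := lt_two_pow_two_pow_size_size q
    have h := lcpProtocol_race (enc := enc) (K := K) (flag := true) (r := r) hq q.size.size 0
      (by rwa [Nat.zero_add])
    rw [Nat.zero_add] at h
    exact LcpRun.alice (s := LcpState.source i) rfl h
  | false =>
    exact LcpRun.alice (s := LcpState.source i) rfl
      (lcpProtocol_scale (enc := enc) (K := K) (flag := false) (r := r) hq)

/-- Only galloping could run forever. Once `2 ^ d` exceeds Alice's phrase count her key is 0 and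
Bob's is not; the hash of 0 collides with no other, so the test fails for every coin string. -/
theorem lcpProtocol_halts (enc : List (List α) → ℕ) (K : ℕ) (flag : Bool) (r : CoinString)
    (A B : List α) : ∃ z k c, LcpRun enc K flag r A B (.gallop 0) z k c := by
  have hex : ∃ d, hashTest K r (phraseKey enc 0 A) (phraseKey enc 1 B) (2 * d) (2 ^ d) = false := by
    refine ⟨(lz77Parse A).length, ?_⟩
    have hB : phraseKey enc 1 B (2 ^ (lz77Parse A).length) ≠ 0 := by
      unfold phraseKey; split_ifs <;> omega
    have hA : phraseKey enc 0 A (2 ^ (lz77Parse A).length) = 0 :=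
      if_neg (not_le.2 Nat.lt_two_pow_self)
    rw [hashTest, hA, coinHash_zero]
    exact decide_eq_false (coinHash_ne_zero K r _ hB).symm
  classical
  exact ⟨_, _, _, lcpProtocol_search
    (fun d hd => by simpa using Nat.find_min hex hd) (Nat.find_spec hex) (lcpProtocol_source rfl)⟩

theorem lcpProtocol_correct (henc : Function.Injective enc) {t : ℕ}
    (ht : ∀ i, AgreeOnPhrases A B i ↔ i ≤ t)
    (h₁ : hashTest K r (phraseKey enc 0 A) (phraseKey enc 1 B) (2 * t.size) (2 ^ t.size) = false)
    (h₂ : pathLow t.size (hashPath K t.size (phraseKey enc 0 A) (phraseKey enc 1 B) r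
      (2 * (t.size + 1))) = t) :
    LcpRun enc K flag r A B (.gallop 0) (lcpLength A B)
      (finalRounds flag (lcpLength A B) + 6 * (t.size + 1))
      (finalBits flag (lcpLength A B) A.length (lcpLength A B) +
        3 * (t.size + 1) * (4 * K + 10)) := by
  have hagree : AgreeOnPhrases A B t := (ht t).2 le_rfl
  have hmin := lcpLength_eq_min_matchEnd hagree (fun h => absurd ((ht _).1 h) (by omega))
  -- Galloping passes every `2 ^ d ≤ t` with certainty, so only the test at `2 ^ t.size` can err.
  refine lcpProtocol_search (fun d hd => hashTest_of_eq K r _ ((phraseKey_eq_iff henc).2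
    ((ht _).2 (Nat.lt_size.1 hd)))) h₁ ?_
  rw [h₂]
  refine (lcpProtocol_source hmin).mono le_rfl ?_
  have hs := Nat.size_le_size ((bestSource_le A t).trans hagree.phraseStart_le_lcpLength)
  have ha := Nat.size_le_size (Nat.size_le_size (Nat.size_le_size
    (matchEnd_le_length A t (bestSource A t))))
  unfold finalBits
  cases flag
  · simp only [Bool.false_eq_true, if_false]; omega
  · simp only [if_true]; omega

end Protocol

/-! ### Logarithmic bounds -/

theorem one_le_lg (x : ℝ) : 1 ≤ lg x := by
  rw [lg, Real.le_logb_iff_rpow_le (by norm_num) (by positivity)]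
  simp

theorem lg_mono {x y : ℝ} (h : x ≤ y) : lg x ≤ lg y :=
  Real.logb_le_logb_of_le (by norm_num) (by positivity) (max_le_max_right 2 h)

theorem lg_two_mul_le (x : ℝ) : lg (2 * x) ≤ lg x + 1 := by
  have h : max (2 * x) 2 ≤ 2 * max x 2 := by
    refine max_le ?_ ?_
    · linarith [le_max_left x 2]
    · linarith [le_max_right x 2]
  calc lg (2 * x) ≤ Real.logb 2 (2 * max x 2) :=
        Real.logb_le_logb_of_le (by norm_num) (by positivity) h
    _ = lg x + 1 := by
        rw [Real.logb_mul (by norm_num) (by positivity), Real.logb_self_eq_one (by norm_num), lg,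
          add_comm]

theorem size_le_lg_add_one (n : ℕ) : (n.size : ℝ) ≤ lg n + 1 := by
  rcases h : n.size with _ | m
  · have := one_le_lg n
    push_cast
    linarith
  · have h1 : 2 ^ m ≤ n := Nat.lt_size.1 (by omega)
    have h2 : (m : ℝ) ≤ lg n := by
      rw [lg, Real.le_logb_iff_rpow_le (by norm_num) (by positivity), Real.rpow_natCast]
      exact le_max_of_le_left (by exact_mod_cast h1)
    push_cast
    linarith

theorem size_le_two_mul_lg (n : ℕ) : (n.size : ℝ) ≤ 2 * lg n := by
  linarith [size_le_lg_add_one n, one_le_lg n]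

theorem size_size_le (n : ℕ) : (n.size.size : ℝ) ≤ 3 * lg (lg n) := by
  linarith [size_le_lg_add_one n.size, lg_mono (size_le_two_mul_lg n), lg_two_mul_le (lg n),
    one_le_lg (lg n)]

theorem size_size_size_le (n : ℕ) : (n.size.size.size : ℝ) ≤ 4 * lg (lg (lg n)) := by
  have h1 : (n.size.size : ℝ) ≤ 2 * (2 * lg (lg n)) := by
    linarith [size_size_le n, one_le_lg (lg n)]
  linarith [size_le_lg_add_one n.size.size, lg_mono h1, lg_two_mul_le (2 * lg (lg n)),
    lg_two_mul_le (lg (lg n)), one_le_lg (lg (lg n))]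

theorem search_rounds_le {t z : ℕ} (h : t ≤ z) : ((6 * (t.size + 1) : ℕ) : ℝ) ≤ 18 * lg z := by
  have h1 := size_le_two_mul_lg z
  have h2 : (t.size : ℝ) ≤ z.size := by exact_mod_cast Nat.size_le_size h
  push_cast
  linarith [one_le_lg z]

theorem search_bits_le {t l : ℕ} (h : t ≤ l) (M : ℕ) :
    ((3 * (t.size + 1) * M : ℕ) : ℝ) ≤ 9 * M * lg l := by
  have h1 := size_le_two_mul_lg l
  have h2 : (t.size : ℝ) ≤ l.size := by exact_mod_cast Nat.size_le_size h
  push_cast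
  have h3 : (t.size : ℝ) + 1 ≤ 3 * lg l := by linarith [one_le_lg l]
  have hM : (0 : ℝ) ≤ M := Nat.cast_nonneg M
  nlinarith

theorem finalRounds_true_le (l : ℕ) : (finalRounds true l : ℝ) ≤ 9 * lg (lg l) := by
  simp only [finalRounds, if_true]
  push_cast
  linarith [size_size_le l, one_le_lg (lg l)]

theorem finalRounds_false_le (l : ℕ) (x : ℝ) : (finalRounds false l : ℝ) ≤ 4 * lg x := by
  have : finalRounds false l = 4 := rfl
  rw [this]
  push_cast
  linarith [one_le_lg x]

theorem finalBits_true_le (a l : ℕ) : (finalBits true l a l : ℝ) ≤ 40 * lg l := by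
  have h1 : finalBits true l a l ≤ 12 * l.size + 11 := by
    have h2 := two_pow_size_le l.size
    have h3 : l.size.size ≤ l.size := Nat.size_le.2 Nat.lt_two_pow_self
    simp only [finalBits, if_true]
    omega
  have h4 : (finalBits true l a l : ℝ) ≤ 12 * l.size + 11 := by exact_mod_cast h1
  linarith [size_le_two_mul_lg l, one_le_lg l]

theorem finalBits_false_le (a l : ℕ) :
    (finalBits false l a l : ℝ) ≤ 40 * (lg l + lg (lg (lg a))) := by
  have h : finalBits false l a l = 2 * a.size.size.size + 6 * l.size + 8 + (2 * l.size + 1) := rfl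
  rw [h]
  push_cast
  linarith [size_le_two_mul_lg l, one_le_lg l, size_size_size_le a, one_le_lg (lg (lg a))]

/-! ### The main theorem -/

theorem solvesLcp_lcpProtocol {α : Type*} [DecidableEq α] {enc : List (List α) → ℕ}
    (henc : Function.Injective enc) (K : ℕ) (flag : Bool) {ε : ℝ}
    (hK : 9 * 2⁻¹ ^ K ≤ ENNReal.ofReal ε) {rounds bits : List α → List α → ℝ}
    (hrounds : ∀ A B, ∀ t ≤ lcpPhrases A B,
      ((finalRounds flag (lcpLength A B) + 6 * (t.size + 1) : ℕ) : ℝ) ≤ rounds A B)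
    (hbits : ∀ A B, ∀ t ≤ lcpLength A B,
      ((finalBits flag (lcpLength A B) A.length (lcpLength A B) +
        3 * (t.size + 1) * (4 * K + 10) : ℕ) : ℝ) ≤ bits A B) :
    SolvesLcp (fun r => (lcpProtocol enc K flag r).toDet) ε rounds bits := by
  refine ⟨fun r A B => ?_, fun A B => ?_⟩
  · obtain ⟨z, k, c, h⟩ := lcpProtocol_halts enc K flag r A B
    obtain ⟨k', -, c', -, h'⟩ := MessageProtocol.RunLE.executes h
    exact ⟨z, k', c', h'⟩
  · obtain ⟨t, ht⟩ := exists_last_agreeOnPhrases A B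
    have hagree : AgreeOnPhrases A B t := (ht t).2 le_rfl
    -- The failure event is only included in the event of a failed search, so its measurability is
    -- not needed.
    refine (measure_mono fun r hr => ?_).trans ((coinMeasure_search_le (t := t) K
      (f := phraseKey enc 0 A) (g := phraseKey enc 1 B)
      (fun i => (phraseKey_eq_iff henc).trans (ht i))).trans hK)
    intro hgood
    refine hr ?_
    obtain ⟨k, hk, c, hc, h⟩ := MessageProtocol.RunLE.executes
      (lcpProtocol_correct (flag := flag) henc ht hgood.1 hgood.2)
    refine ⟨k, c, h, ?_, ?_⟩
    · exact (Nat.cast_le.2 hk).trans (hrounds A B t hagree.le_lcpPhrases)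
    · exact (Nat.cast_le.2 hc).trans (hbits A B t hagree.le_lcpLength)

theorem exists_hash_length {ε : ℝ} (hε : 0 < ε) :
    ∃ K : ℕ, 9 * 2⁻¹ ^ K ≤ ENNReal.ofReal ε := by
  obtain ⟨K, hK⟩ := exists_pow_lt_of_lt_one (show 0 < ε / 9 by positivity)
    (show (2⁻¹ : ℝ) < 1 by norm_num)
  refine ⟨K, ?_⟩
  have h : (9 * 2⁻¹ ^ K : ENNReal) = ENNReal.ofReal (9 * 2⁻¹ ^ K) := by
    rw [ENNReal.ofReal_mul (by norm_num), ENNReal.ofReal_pow (by norm_num),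
      ENNReal.ofReal_inv_of_pos (by norm_num)]
    simp
  rw [h]
  exact ENNReal.ofReal_le_ofReal (by linarith)

theorem theorem3 (ε : ℝ) (hε₀ : 0 < ε) (hε₁ : ε < 1 / 2) :
    (∃ C : ℝ, ∀ (α : Type*) [DecidableEq α] [Countable α],
      ∃ P : PublicCoinProtocol (List α) (List α) ℕ,
        SolvesLcp P ε
          (fun A B => C * (lg (lcpPhrases A B) + lg (lg (lcpLength A B))))
          (fun A B => C * lg (lcpLength A B))) ∧
    (∃ C : ℝ, ∀ (α : Type*) [DecidableEq α] [Countable α],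
      ∃ P : PublicCoinProtocol (List α) (List α) ℕ,
        SolvesLcp P ε
          (fun A B => C * lg (lcpPhrases A B))
          (fun A B => C * (lg (lcpLength A B) + lg (lg (lg A.length))))) := by
  obtain ⟨K, hK⟩ := exists_hash_length hε₀
  have hM : (0 : ℝ) ≤ 9 * ((4 * K + 10 : ℕ) : ℝ) := by positivity
  -- The product pays for the bits of the search and 40 for those of the final phase; the round
  -- bounds have smaller constants. `K` comes from `ε` before the alphabet is introduced, so the
  -- constant is uniform in the alphabet.
  refine ⟨⟨9 * ((4 * K + 10 : ℕ) : ℝ) + 40, fun α _ _ => ?_⟩,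
    ⟨9 * ((4 * K + 10 : ℕ) : ℝ) + 40, fun α _ _ => ?_⟩⟩
  · obtain ⟨enc, henc⟩ := exists_injective_nat (List (List α))
    refine ⟨_, solvesLcp_lcpProtocol henc K true hK (fun A B t ht => ?_) (fun A B t ht => ?_)⟩
    · rw [Nat.cast_add]
      nlinarith [search_rounds_le ht, finalRounds_true_le (lcpLength A B),
        one_le_lg (lcpPhrases A B), one_le_lg (lg (lcpLength A B))]
    · rw [Nat.cast_add]
      nlinarith [search_bits_le ht (4 * K + 10), finalBits_true_le A.length (lcpLength A B)]
  · obtain ⟨enc, henc⟩ := exists_injective_nat (List (List α))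
    refine ⟨_, solvesLcp_lcpProtocol henc K false hK (fun A B t ht => ?_) (fun A B t ht => ?_)⟩
    · rw [Nat.cast_add]
      nlinarith [search_rounds_le ht, finalRounds_false_le (lcpLength A B) (lcpPhrases A B),
        one_le_lg (lcpPhrases A B)]
    · rw [Nat.cast_add]
      nlinarith [search_bits_le ht (4 * K + 10), finalBits_false_le A.length (lcpLength A B),
        one_le_lg (lg (lg A.length))]
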